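/- **Conventions.** Let $\mathbf k\subseteq\mathbb C$ be a field and $\lambda\in\mathbf k$. A *Hoffman set* is a set $X$ that is the disjoint union of finite sets $X_n$, $n\ge 1$ (elements of $X_n$ have degree $n$), with a pairing $[\cdot,\cdot]$ on $X\cup\{0\}$ such that $[a,0]=0$, $[a,b]=[b,a]$, $[[a,b],c]=[a,[b,c]]$ for all $a,b,c$, and either $[\cdot,\cdot]$ is identically $0$ or $\deg[a,b]=\deg a+\deg b$ for all letters $a,b\in X$ with $[a,b]\neq 0$. Let $A=\mathbf k\{X\}$ be the free $\mathbf k$-module on $X$ with the bilinear extension of $[\cdot,\cdot]$ as product (a commutative algebra without identity), and let $\tilde A=\mathbf k\oplus A$ be its unitization, with identity $\mathbf 1_A$. For a commutative, not necessarily unital, $\mathbf k$-algebra $B$ let $Ш^+(B)=\bigoplus_{n\ge 0}B^{\otimes n}$ with the mixable shuffle product $\diamond^+$ of weight $\lambda$: the bilinear product for which the empty tensor $\mathbf 1\in B^{\otimes 0}=\mathbf k$ is the identity and $$(a\otimes u)\diamond^+(b\otimes v)=a\otimes\big(u\diamond^+(b\otimes v)\big)+b\otimes\big((a\otimes u)\diamond^+v\big)+\lambda\,ab\otimes(u\diamond^+v)$$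 for $a,b\in B$ and pure tensors $u,v$ of length $\ge 0$. (A tensor of length $0$ on the right of $\otimes$ is dropped.) If $B$ is unital, let $Ш(B)=B\otimes Ш^+(B)$ be the tensor product algebra. Let $\gamma^+:Ш^+(\mathbf k)\to Ш^+(\tilde A)$ be the algebra homomorphism $\mathbf 1_{\mathbf k}^{\otimes n}\mapsto\mathbf 1_A^{\otimes n}$ and $\gamma:Ш(\mathbf k)\to Ш(\tilde A)$ the algebra homomorphism $\mathbf 1_{\mathbf k}\otimes\mathbf 1_{\mathbf k}^{\otimes n}\mapsto\mathbf 1_A\otimes\mathbf 1_A^{\otimes n}$, $n\ge 0$. Let $Ш^+(A)\to Ш^+(\tilde A)$ be induced by $A\subseteq\tilde A$, and $Ш^+(A)\to Ш(\tilde A)$ be $a\mapsto \mathbf 1_A\otimes a$, with image $\mathbf 1_A\otimes Ш^+(A)$. The product of two subalgebras is the span of all products of their elements. **Theorem 3.3.** The following hold. (0) The algebras $Ш^+(\mathbf k)$ and $Ш(\mathbf k)$ have Hopf algebra structures (the $\lambda$-divided power structure) given on the basis $u_n=\mathbf 1_{\mathbf k}^{\otimes n}$, respectively $u_n=\mathbf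 1_{\mathbf k}\otimes\mathbf 1_{\mathbf k}^{\otimes n}$, by $$\Delta(u_n)=\sum_{j=0}^{n}\sum_{i=0}^{n-j}(-\lambda)^j\,u_i\otimes u_{n-j-i},\qquad \varepsilon(u_0)=1,\quad \varepsilon(u_1)=\lambda,\quad \varepsilon(u_n)=0\ (n\ge 2),$$ and $Ш^+(A)$ has a Hopf algebra structure (the quasi-shuffle structure) given by the deconcatenation coproduct $\Delta(a_1\otimes\cdots\otimes a_n)=\sum_{i=0}^n(a_1\otimes\cdots\otimes a_i)\otimes(a_{i+1}\otimes\cdots\otimes a_n)$ and by the counit with $\varepsilon(\mathbf 1)=1$ and $\varepsilon(a_1\otimes\cdots\otimes a_n)=0$ for $n\ge1$. The maps $\gamma^+$, $\gamma$, $Ш^+(A)\to Ш^+(\tilde A)$ and $Ш^+(A)\to Ш(\tilde A)$ are injective, so these structures are also structures on the images $\gamma^+(Ш^+(\mathbf k))$, $\gamma(Ш(\mathbf k))$, $Ш^+(A)$ and $\mathbf 1_A\otimes Ш^+(A)$. (1) The subalgebra $\gamma^+(Ш^+(\mathbf k))\diamond^+Ш^+(A)$ of $Ш^+(\tilde A)$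 has a Hopf algebra structure (with its given product) that expands the Hopf algebra structures of $\gamma^+(Ш^+(\mathbf k))$ and $Ш^+(A)$, i.e. the inclusions of the two factors are homomorphisms of Hopf algebras (compatible with coproduct, counit and antipode). (2) The subalgebra $\gamma(Ш(\mathbf k))\cdot(\mathbf 1_A\otimes Ш^+(A))$ of $Ш(\tilde A)$ has a Hopf algebra structure (with its given product) that expands, in the same sense, the Hopf algebra structures of $\gamma(Ш(\mathbf k))$ and $\mathbf 1_A\otimes Ш^+(A)$. -/

import Mathlib

open scoped TensorProduct

noncomputable section

namespace MixableShuffle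

/-! ### Hopf algebra structures on a given algebra -/

/-- A Hopf algebra structure on a given `R`-algebra `A`: a coalgebra structure whose counit and
comultiplication are multiplicative and unital, together with an antipode. This is the same thing
as an instance of `HopfAlgebra R A` whose underlying algebra is the given one, see
`HopfStructure.toHopfAlgebra`. -/
structure HopfStructure (R A : Type*) [CommRing R] [Ring A] [Algebra R A] extends
    Coalgebra R A where
  counit_one : counit 1 = 1
  counit_mul : ∀ a b : A, counit (a * b) = counit a * counit b
  comul_one : comul 1 = 1
  comul_mul : ∀ a b : A, comul (a * b) = comul a * comul b
  antipode : A →ₗ[R] A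
  mul_antipode_rTensor_comul :
    LinearMap.mul' R A ∘ₗ antipode.rTensor A ∘ₗ comul = Algebra.linearMap R A ∘ₗ counit
  mul_antipode_lTensor_comul :
    LinearMap.mul' R A ∘ₗ antipode.lTensor A ∘ₗ comul = Algebra.linearMap R A ∘ₗ counit

/-- A Hopf algebra structure on the algebra `A` as a Mathlib Hopf algebra. -/
@[reducible] def HopfStructure.toHopfAlgebra {R A : Type*} [CommRing R] [Ring A] [Algebra R A]
    (H : HopfStructure R A) : HopfAlgebra R A :=
  letI : Coalgebra R A := H.toCoalgebra
  { Bialgebra.mk' R A H.counit_one (fun {a b} => H.counit_mul a b) H.comul_one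
      (fun {a b} => H.comul_mul a b) with
    antipode := H.antipode
    mul_antipode_rTensor_comul := H.mul_antipode_rTensor_comul
    mul_antipode_lTensor_comul := H.mul_antipode_lTensor_comul }

/-- The algebra underlying `H.toHopfAlgebra` is the given one. -/
theorem HopfStructure.toHopfAlgebra_toAlgebra {R A : Type*} [CommRing R] [Ring A]
    [inst : Algebra R A] (H : HopfStructure R A) : H.toHopfAlgebra.toAlgebra = inst := rfl

/-- The algebra homomorphism `f` is a homomorphism of Hopf algebras from `(A, H)` to `(B, K)`. -/
structure IsHopfHom {R A B : Type*} [CommRing R] [Ring A] [Ring B] [Algebra R A] [Algebra R B]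
    (H : HopfStructure R A) (K : HopfStructure R B) (f : A →ₐ[R] B) : Prop where
  map_comul : ∀ a, K.comul (f a) = TensorProduct.map f.toLinearMap f.toLinearMap (H.comul a)
  map_counit : ∀ a, K.counit (f a) = H.counit a
  map_antipode : ∀ a, K.antipode (f a) = f (H.antipode a)

/-- The product of the subalgebras `S` and `T` of a commutative algebra, i.e. the span of all
products `s * t` (see `mem_algProd`), which is again a subalgebra. -/
def algProd {R B : Type*} [CommRing R] [CommRing B] [Algebra R B] (S T : Subalgebra R B) :
    Subalgebra R B :=
  S ⊔ T

theorem mem_algProd {R B : Type*} [CommRing R] [CommRing B] [Algebra R B]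
    (S T : Subalgebra R B) (x : B) :
    x ∈ algProd S T ↔ x ∈ Submodule.span R {z | ∃ s ∈ S, ∃ t ∈ T, s * t = z} := by
  have h : Subalgebra.toSubmodule (algProd S T) =
      Submodule.span R {z | ∃ s ∈ S, ∃ t ∈ T, s * t = z} := by
    rw [algProd, ← Subalgebra.mul_toSubmodule, Submodule.mul_eq_span_mul_set]
    rfl
  rw [← h]
  rfl

/-- A Hopf structure `H` on the product of the images of `f` and `g` expands Hopf structures `H₁`
and `H₂` on the two factors: `f` and `g`, with their values in the product, are homomorphisms of
Hopf algebras. -/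
def Expands {R A₁ A₂ B : Type*} [CommRing R] [CommRing A₁] [CommRing A₂] [CommRing B]
    [Algebra R A₁] [Algebra R A₂] [Algebra R B] (f : A₁ →ₐ[R] B) (g : A₂ →ₐ[R] B)
    (H₁ : HopfStructure R A₁) (H₂ : HopfStructure R A₂)
    (H : HopfStructure R (algProd f.range g.range)) : Prop :=
  IsHopfHom H₁ H ((Subalgebra.inclusion (le_sup_left : f.range ≤ algProd f.range g.range)).comp
    f.rangeRestrict) ∧
  IsHopfHom H₂ H ((Subalgebra.inclusion (le_sup_right : g.range ≤ algProd f.range g.range)).comp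
    g.rangeRestrict)

/-! ### The mixable shuffle product -/

section Shuffle

set_option linter.unusedSectionVars false
set_option linter.unnecessarySeqFocus false

variable {R A : Type*} [CommRing R] [NonUnitalCommRing A] [Module R A]

/-- Induction on words for the tensor algebra. -/
theorem word_induction {P : TensorAlgebra R A → Prop} (one : P 1)
    (cons : ∀ (a : A) (u : TensorAlgebra R A), P u → P (TensorAlgebra.ι R a * u))
    (add : ∀ u v, P u → P v → P (u + v)) (smul : ∀ (r : R) u, P u → P (r • u))
    (u : TensorAlgebra R A) : P u := by
  have key : ∀ x y : TensorAlgebra R A, P y → P (x * y) := by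
    intro x
    induction x using TensorAlgebra.induction with
    | algebraMap r => intro y hy; rw [← Algebra.smul_def]; exact smul _ _ hy
    | ι a => intro y hy; exact cons a y hy
    | mul x x' hx hx' => intro y hy; rw [mul_assoc]; exact hx _ (hx' _ hy)
    | add x x' hx hx' => intro y hy; rw [add_mul]; exact add _ _ (hx _ hy) (hx' _ hy)
  simpa using key u 1 one

variable [IsScalarTower R A A] [SMulCommClass R A A]

/-- For a letter `a` and a linear map `L`, thought of as `L v = u ⋄ v`, one step of the recursion
for `v ↦ (a ⊗ u) ⋄ v`; the pair carried along is `(v, (a ⊗ u) ⋄ v)`. -/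
def consStep (lam : R) (a : A) (L : TensorAlgebra R A →ₗ[R] TensorAlgebra R A) :
    A →ₗ[R] Module.End R (TensorAlgebra R A × TensorAlgebra R A) :=
  LinearMap.mk₂ R
    (fun b p => (TensorAlgebra.ι R b * p.1,
      TensorAlgebra.ι R a * L (TensorAlgebra.ι R b * p.1) + TensorAlgebra.ι R b * p.2 +
        lam • (TensorAlgebra.ι R (a * b) * L p.1)))
    (fun b b' p => by ext <;> simp [add_mul, mul_add] <;> abel)
    (fun r b p => by ext <;> simp [mul_smul_comm, smul_comm lam r])
    (fun b p p' => by ext <;> simp [mul_add] <;> abel)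
    (fun r b p => by ext <;> simp [smul_comm lam r])

/-- `v ↦ (v, (a ⊗ u) ⋄ v)`, where `L v = u ⋄ v`. -/
def consAux (lam : R) (a : A) (L : TensorAlgebra R A →ₗ[R] TensorAlgebra R A)
    (v : TensorAlgebra R A) : TensorAlgebra R A × TensorAlgebra R A :=
  TensorAlgebra.lift R (consStep lam a L) v (1, TensorAlgebra.ι R a * L 1)

theorem consAux_one (lam : R) (a : A) (L : TensorAlgebra R A →ₗ[R] TensorAlgebra R A) :
    consAux lam a L 1 = (1, TensorAlgebra.ι R a * L 1) := by
  simp [consAux]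

theorem consAux_add (lam : R) (a : A) (L : TensorAlgebra R A →ₗ[R] TensorAlgebra R A)
    (v w : TensorAlgebra R A) :
    consAux lam a L (v + w) = consAux lam a L v + consAux lam a L w := by
  simp [consAux]

theorem consAux_smul (lam : R) (a : A) (L : TensorAlgebra R A →ₗ[R] TensorAlgebra R A) (r : R)
    (v : TensorAlgebra R A) : consAux lam a L (r • v) = r • consAux lam a L v := by
  simp [consAux]

theorem consAux_fst (lam : R) (a : A) (L : TensorAlgebra R A →ₗ[R] TensorAlgebra R A)
    (v : TensorAlgebra R A) : (consAux lam a L v).1 = v := by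
  induction v using word_induction with
  | one => simp [consAux_one]
  | cons b v hv =>
    have : (consAux lam a L (TensorAlgebra.ι R b * v)).1 =
        TensorAlgebra.ι R b * (consAux lam a L v).1 := by
      simp [consAux, consStep]
    rw [this, hv]
  | add v w hv hw => rw [consAux_add, Prod.fst_add, hv, hw]
  | smul r v hv => rw [consAux_smul, Prod.smul_fst, hv]

theorem consAux_cons (lam : R) (a : A) (L : TensorAlgebra R A →ₗ[R] TensorAlgebra R A)
    (b : A) (v : TensorAlgebra R A) :
    (consAux lam a L (TensorAlgebra.ι R b * v)).2 =
      TensorAlgebra.ι R a * L (TensorAlgebra.ι R b * v) +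
        TensorAlgebra.ι R b * (consAux lam a L v).2 +
        lam • (TensorAlgebra.ι R (a * b) * L v) := by
  have h : (consAux lam a L (TensorAlgebra.ι R b * v)).2 =
      TensorAlgebra.ι R a * L (TensorAlgebra.ι R b * (consAux lam a L v).1) +
        TensorAlgebra.ι R b * (consAux lam a L v).2 +
        lam • (TensorAlgebra.ι R (a * b) * L (consAux lam a L v).1) := by
    simp [consAux, consStep]
  rw [h, consAux_fst]

/-- `(a, L) ↦ (v ↦ (a ⊗ u) ⋄ v)`, where `L v = u ⋄ v`. -/
def consOp (lam : R) : A →ₗ[R] Module.End R (Module.End R (TensorAlgebra R A)) :=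
  LinearMap.mk₂ R
    (fun a L =>
      { toFun := fun v => (consAux lam a L v).2
        map_add' := fun v w => by rw [consAux_add]; rfl
        map_smul' := fun r v => by rw [consAux_smul]; rfl })
    (fun a a' L => by
      ext v
      simp only [LinearMap.coe_mk, AddHom.coe_mk, LinearMap.add_apply]
      induction v using word_induction with
      | one => simp [consAux_one, add_mul]
      | cons b v hv => simp only [consAux_cons, hv, map_add, add_mul, mul_add, smul_add]; abel
      | add v w hv hw => simp only [consAux_add, Prod.snd_add, hv, hw]; abel
      | smul r v hv => simp only [consAux_smul, Prod.smul_snd, hv, smul_add])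
    (fun r a L => by
      ext v
      simp only [LinearMap.coe_mk, AddHom.coe_mk, LinearMap.smul_apply]
      induction v using word_induction with
      | one => simp [consAux_one]
      | cons b v hv =>
        simp only [consAux_cons, hv, map_smul, smul_mul_assoc, mul_smul_comm, smul_add,
          smul_comm lam r]
      | add v w hv hw => simp only [consAux_add, Prod.snd_add, hv, hw, smul_add]
      | smul s v hv => simp only [consAux_smul, Prod.smul_snd, hv, smul_comm s r])
    (fun a L L' => by
      ext v
      simp only [LinearMap.coe_mk, AddHom.coe_mk, LinearMap.add_apply]
      induction v using word_induction with
      | one => simp [consAux_one, mul_add]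
      | cons b v hv =>
        simp only [consAux_cons, hv, LinearMap.add_apply, mul_add, smul_add]; abel
      | add v w hv hw => simp only [consAux_add, Prod.snd_add, hv, hw]; abel
      | smul r v hv => simp only [consAux_smul, Prod.smul_snd, hv, smul_add])
    (fun r a L => by
      ext v
      simp only [LinearMap.coe_mk, AddHom.coe_mk, LinearMap.smul_apply]
      induction v using word_induction with
      | one => simp [consAux_one]
      | cons b v hv =>
        simp only [consAux_cons, hv, LinearMap.smul_apply, mul_smul_comm, smul_add,
          smul_comm lam r]
      | add v w hv hw => simp only [consAux_add, Prod.snd_add, hv, hw, smul_add]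
      | smul s v hv => simp only [consAux_smul, Prod.smul_snd, hv, smul_comm s r])

/-- The mixable shuffle product of weight `lam` on `⨁ₙ A^{⊗ n}` as a bilinear map. It is
determined by `mixShuffle_one_left`, `mixShuffle_one_right` and `mixShuffle_cons_cons`. -/
def mixShuffle (lam : R) :
    TensorAlgebra R A →ₗ[R] TensorAlgebra R A →ₗ[R] TensorAlgebra R A :=
  (LinearMap.applyₗ (R := R) (LinearMap.id : TensorAlgebra R A →ₗ[R] TensorAlgebra R A)).comp
    (TensorAlgebra.lift R (consOp lam)).toLinearMap

theorem mixShuffle_one_left (lam : R) (v : TensorAlgebra R A) : mixShuffle lam 1 v = v := by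
  simp [mixShuffle]

theorem mixShuffle_cons (lam : R) (a : A) (u v : TensorAlgebra R A) :
    mixShuffle lam (TensorAlgebra.ι R a * u) v = (consAux lam a (mixShuffle lam u) v).2 := by
  simp [mixShuffle, consOp]

/-- `(a ⊗ u) ⋄ (b ⊗ v) = a ⊗ (u ⋄ (b ⊗ v)) + b ⊗ ((a ⊗ u) ⋄ v) + λ ab ⊗ (u ⋄ v)`. -/
theorem mixShuffle_cons_cons (lam : R) (a b : A) (u v : TensorAlgebra R A) :
    mixShuffle lam (TensorAlgebra.ι R a * u) (TensorAlgebra.ι R b * v) =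
      TensorAlgebra.ι R a * mixShuffle lam u (TensorAlgebra.ι R b * v) +
        TensorAlgebra.ι R b * mixShuffle lam (TensorAlgebra.ι R a * u) v +
        lam • (TensorAlgebra.ι R (a * b) * mixShuffle lam u v) := by
  rw [mixShuffle_cons, consAux_cons, ← mixShuffle_cons]

theorem mixShuffle_one_right (lam : R) (u : TensorAlgebra R A) : mixShuffle lam u 1 = u := by
  induction u using word_induction with
  | one => exact mixShuffle_one_left lam 1
  | cons a u hu => rw [mixShuffle_cons, consAux_one, hu]
  | add u v hu hv => rw [map_add, LinearMap.add_apply, hu, hv]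
  | smul r u hu => rw [map_smul, LinearMap.smul_apply, hu]

theorem mixShuffle_comm (lam : R) (u v : TensorAlgebra R A) :
    mixShuffle lam u v = mixShuffle lam v u := by
  induction u using word_induction generalizing v with
  | one => rw [mixShuffle_one_left, mixShuffle_one_right]
  | cons a u hu =>
    induction v using word_induction with
    | one => rw [mixShuffle_one_left, mixShuffle_one_right]
    | cons b v hv =>
      rw [mixShuffle_cons_cons, mixShuffle_cons_cons, hu, hu, hv, mul_comm a b]
      abel
    | add v w hv hw => rw [map_add, map_add, LinearMap.add_apply, hv, hw]
    | smul r v hv => rw [map_smul, map_smul, LinearMap.smul_apply, hv]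
  | add u u' hu hu' => rw [map_add, map_add, LinearMap.add_apply, hu, hu']
  | smul r u hu => rw [map_smul, map_smul, LinearMap.smul_apply, hu]

theorem mixShuffle_assoc (lam : R) (u v w : TensorAlgebra R A) :
    mixShuffle lam (mixShuffle lam u v) w = mixShuffle lam u (mixShuffle lam v w) := by
  induction u using word_induction generalizing v w with
  | one => simp only [mixShuffle_one_left]
  | cons a u hu =>
    induction v using word_induction generalizing w with
    | one => simp only [mixShuffle_one_left, mixShuffle_one_right]
    | cons b v hv =>
      induction w using word_induction with
      | one => simp only [mixShuffle_one_right]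
      | cons c w hw =>
        have hl : mixShuffle lam (mixShuffle lam (TensorAlgebra.ι R a * u)
              (TensorAlgebra.ι R b * v)) (TensorAlgebra.ι R c * w) =
            TensorAlgebra.ι R a * mixShuffle lam (mixShuffle lam u (TensorAlgebra.ι R b * v))
                (TensorAlgebra.ι R c * w) +
              TensorAlgebra.ι R b * mixShuffle lam (mixShuffle lam (TensorAlgebra.ι R a * u) v)
                (TensorAlgebra.ι R c * w) +
              lam • (TensorAlgebra.ι R (a * b) * mixShuffle lam (mixShuffle lam u v)
                (TensorAlgebra.ι R c * w)) +
              TensorAlgebra.ι R c * mixShuffle lam (mixShuffle lam (TensorAlgebra.ι R a * u)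
                (TensorAlgebra.ι R b * v)) w +
              lam • (TensorAlgebra.ι R (a * c) *
                mixShuffle lam (mixShuffle lam u (TensorAlgebra.ι R b * v)) w) +
              lam • (TensorAlgebra.ι R (b * c) *
                mixShuffle lam (mixShuffle lam (TensorAlgebra.ι R a * u) v) w) +
              lam • lam • (TensorAlgebra.ι R (a * b * c) *
                mixShuffle lam (mixShuffle lam u v) w) := by
          simp only [mixShuffle_cons_cons lam a b, map_add, map_smul, LinearMap.add_apply,
            LinearMap.smul_apply, mixShuffle_cons_cons lam _ c, mul_add, smul_add, mul_smul_comm]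
          abel
        have hr : mixShuffle lam (TensorAlgebra.ι R a * u) (mixShuffle lam
              (TensorAlgebra.ι R b * v) (TensorAlgebra.ι R c * w)) =
            TensorAlgebra.ι R a * mixShuffle lam u (mixShuffle lam (TensorAlgebra.ι R b * v)
                (TensorAlgebra.ι R c * w)) +
              TensorAlgebra.ι R b * mixShuffle lam (TensorAlgebra.ι R a * u) (mixShuffle lam v
                (TensorAlgebra.ι R c * w)) +
              lam • (TensorAlgebra.ι R (a * b) * mixShuffle lam u (mixShuffle lam v
                (TensorAlgebra.ι R c * w))) +
              TensorAlgebra.ι R c * mixShuffle lam (TensorAlgebra.ι R a * u) (mixShuffle lam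
                (TensorAlgebra.ι R b * v) w) +
              lam • (TensorAlgebra.ι R (a * c) *
                mixShuffle lam u (mixShuffle lam (TensorAlgebra.ι R b * v) w)) +
              lam • (TensorAlgebra.ι R (b * c) *
                mixShuffle lam (TensorAlgebra.ι R a * u) (mixShuffle lam v w)) +
              lam • lam • (TensorAlgebra.ι R (a * b * c) *
                mixShuffle lam u (mixShuffle lam v w)) := by
          simp only [mixShuffle_cons_cons lam b c, map_add, map_smul,
            mixShuffle_cons_cons lam a, mul_add, smul_add, mul_smul_comm, mul_assoc a b c]
          abel
        rw [hl, hr, hu, hu, hu, hu, hv, hv, hw]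
      | add w w' hw hw' => simp only [map_add, hw, hw']
      | smul r w hw => simp only [map_smul, hw]
    | add v v' hv hv' => simp only [map_add, LinearMap.add_apply, hv, hv']
    | smul r v hv => simp only [map_smul, LinearMap.smul_apply, hv]
  | add u u' hu hu' => simp only [map_add, LinearMap.add_apply, hu, hu']
  | smul r u hu => simp only [map_smul, LinearMap.smul_apply, hu]

end Shuffle

/-! ### The algebras `Ш⁺(A)` and `Ш(A)` -/

section Sh

set_option linter.unusedSectionVars false

/-- `Ш⁺(A) = ⨁ₙ A^{⊗ n}` for a commutative, not necessarily unital, `R`-algebra `A`. Its product is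
the mixable shuffle product of weight `lam`, not the concatenation product. -/
def ShPlus (R A : Type*) [CommRing R] [NonUnitalCommRing A] [Module R A] (_lam : R) : Type _ :=
  TensorAlgebra R A

variable {R A B : Type*} [CommRing R] [NonUnitalCommRing A] [Module R A]
  [NonUnitalCommRing B] [Module R B] {lam : R}

namespace ShPlus

instance : AddCommGroup (ShPlus R A lam) := inferInstanceAs (AddCommGroup (TensorAlgebra R A))

instance : Module R (ShPlus R A lam) := inferInstanceAs (Module R (TensorAlgebra R A))

/-- The identification of the module `Ш⁺(A)` with the tensor module. -/
def of : TensorAlgebra R A ≃ₗ[R] ShPlus R A lam := LinearEquiv.refl R (TensorAlgebra R A)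

/-- The pure tensor `a₁ ⊗ ⋯ ⊗ aₙ` in `Ш⁺(A)`. -/
def word (l : List A) : ShPlus R A lam := of (l.map (TensorAlgebra.ι R)).prod

/-- Left concatenation with one letter, `u ↦ a ⊗ u`. -/
def cons (a : A) : ShPlus R A lam →ₗ[R] ShPlus R A lam :=
  of.toLinearMap ∘ₗ LinearMap.mulLeft R (TensorAlgebra.ι R a) ∘ₗ of.symm.toLinearMap

variable [IsScalarTower R A A] [SMulCommClass R A A] [IsScalarTower R B B] [SMulCommClass R B B]

instance : One (ShPlus R A lam) := ⟨of 1⟩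

instance : Mul (ShPlus R A lam) := ⟨fun u v => of (mixShuffle lam (of.symm u) (of.symm v))⟩

theorem mul_def (u v : ShPlus R A lam) : u * v = of (mixShuffle lam (of.symm u) (of.symm v)) := rfl

theorem one_def : (1 : ShPlus R A lam) = of 1 := rfl

instance : CommRing (ShPlus R A lam) :=
  { (inferInstance : AddCommGroup (ShPlus R A lam)),
    (inferInstance : One (ShPlus R A lam)),
    (inferInstance : Mul (ShPlus R A lam)) with
    left_distrib := fun u v w => by simp [mul_def]
    right_distrib := fun u v w => by simp [mul_def]
    zero_mul := fun u => by simp [mul_def]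
    mul_zero := fun u => by simp [mul_def]
    mul_assoc := fun u v w => by simp [mul_def, mixShuffle_assoc]
    one_mul := fun u => by simp [mul_def, one_def, mixShuffle_one_left]
    mul_one := fun u => by simp [mul_def, one_def, mixShuffle_one_right]
    mul_comm := fun u v => by simp only [mul_def, mixShuffle_comm lam (of.symm u)] }

instance : Algebra R (ShPlus R A lam) :=
  Algebra.ofModule (fun r u v => by simp [mul_def]) (fun r u v => by simp [mul_def])

/-- The empty word is the identity. -/
theorem word_nil : (word [] : ShPlus R A lam) = 1 := rfl

theorem word_cons (a : A) (l : List A) : (word (a :: l) : ShPlus R A lam) = cons a (word l) := by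
  simp [word, cons]

/-- The defining recursion of the mixable shuffle product on pure tensors. -/
theorem word_cons_mul_word_cons (a b : A) (l m : List A) :
    (word (a :: l) * word (b :: m) : ShPlus R A lam) =
      cons a (word l * word (b :: m)) + cons b (word (a :: l) * word m) +
        lam • cons (a * b) (word l * word m) := by
  simp [word, cons, mul_def, mixShuffle_cons_cons]

theorem map_mixShuffle (f : A →ₙₐ[R] B) (u v : TensorAlgebra R A) :
    TensorAlgebra.lift R (TensorAlgebra.ι R ∘ₗ (f : A →ₗ[R] B)) (mixShuffle lam u v) =
      mixShuffle lam (TensorAlgebra.lift R (TensorAlgebra.ι R ∘ₗ (f : A →ₗ[R] B)) u)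
        (TensorAlgebra.lift R (TensorAlgebra.ι R ∘ₗ (f : A →ₗ[R] B)) v) := by
  induction u using word_induction generalizing v with
  | one => simp only [mixShuffle_one_left, map_one]
  | cons a u hu =>
    induction v using word_induction with
    | one => simp only [mixShuffle_one_right, map_one]
    | cons b v hv =>
      simp only [map_mul, map_add, map_smul, mixShuffle_cons_cons, hu, hv,
        TensorAlgebra.lift_ι_apply, LinearMap.comp_apply, LinearMap.coe_coe]
    | add v w hv hw => simp only [map_add, hv, hw]
    | smul r v hv => simp only [map_smul, hv]
  | add u u' hu hu' => simp only [map_add, LinearMap.add_apply, hu, hu']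
  | smul r u hu => simp only [map_smul, LinearMap.smul_apply, hu]

/-- The algebra homomorphism `Ш⁺(A) → Ш⁺(B)`, `a₁ ⊗ ⋯ ⊗ aₙ ↦ f a₁ ⊗ ⋯ ⊗ f aₙ`, induced by a
homomorphism `f` of not necessarily unital algebras. -/
def map (f : A →ₙₐ[R] B) : ShPlus R A lam →ₐ[R] ShPlus R B lam :=
  AlgHom.ofLinearMap
    (of.toLinearMap ∘ₗ
      (TensorAlgebra.lift R (TensorAlgebra.ι R ∘ₗ (f : A →ₗ[R] B))).toLinearMap ∘ₗ
      of.symm.toLinearMap)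
    (by simp [one_def])
    (fun u v => by simp [mul_def, map_mixShuffle])

theorem map_word (f : A →ₙₐ[R] B) (l : List A) :
    map f (word l : ShPlus R A lam) = word (l.map f) := by
  simp only [map, word, AlgHom.ofLinearMap_apply, LinearMap.comp_apply, LinearEquiv.coe_coe,
    LinearEquiv.symm_apply_apply, AlgHom.toLinearMap_apply, map_list_prod, List.map_map]
  congr 3
  funext a
  simp

end ShPlus

/-- `Ш(A) = A ⊗ Ш⁺(A)` for a commutative unital `R`-algebra `A`, with the product
`(a₀ ⊗ u) ⋄ (b₀ ⊗ v) = a₀ b₀ ⊗ (u ⋄⁺ v)`. -/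
abbrev Sh (R A : Type*) [CommRing R] [CommRing A] [Algebra R A] (lam : R) : Type _ :=
  A ⊗[R] ShPlus R A lam

end Sh

section Gamma

variable (R C : Type*) [CommRing R] [CommRing C] [Algebra R C] (lam : R)

/-- `γ⁺ : Ш⁺(R) → Ш⁺(C)`, `1_R^{⊗ n} ↦ 1_C^{⊗ n}`. -/
def gammaPlus : ShPlus R R lam →ₐ[R] ShPlus R C lam :=
  ShPlus.map ((Algebra.ofId R C : R →ₐ[R] C) : R →ₙₐ[R] C)

/-- `γ : Ш(R) → Ш(C)`, `1_R ⊗ 1_R^{⊗ n} ↦ 1_C ⊗ 1_C^{⊗ n}`. -/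
def gamma : Sh R R lam →ₐ[R] Sh R C lam :=
  Algebra.TensorProduct.map (Algebra.ofId R C) (gammaPlus R C lam)

variable {R}

/-- The element `1_R^{⊗ n}` of `Ш⁺(R)`. -/
def onePow (n : ℕ) : ShPlus R R lam := ShPlus.word (List.replicate n 1)

theorem gammaPlus_onePow (n : ℕ) :
    gammaPlus R C lam (onePow lam n) = ShPlus.word (List.replicate n 1) := by
  simp only [gammaPlus, onePow, ShPlus.map_word, List.map_replicate]
  exact congrArg (fun c => ShPlus.word (List.replicate n c)) (map_one (Algebra.ofId R C))

theorem gamma_onePow (n : ℕ) :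
    gamma R C lam (1 ⊗ₜ onePow lam n) = 1 ⊗ₜ ShPlus.word (List.replicate n 1) := by
  simp [gamma, gammaPlus_onePow]

end Gamma

/-! ### The Hopf structures on the two factors -/

/-- The coalgebra structure of the `lam`-divided power Hopf algebra with respect to the basis
`u 0, u 1, …`:
`Δ uₙ = ∑_{j ≤ n} ∑_{i ≤ n - j} (-λ)ʲ uᵢ ⊗ u_{n - j - i}`, `ε u₀ = 1`, `ε u₁ = λ` and `ε uₙ = 0` for
`n ≥ 2`. Both maps are determined by these formulas, and the antipode by the axioms. -/
structure IsDividedPower {R A : Type*} [CommRing R] [Ring A] [Algebra R A]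
    (H : HopfStructure R A) (lam : R) (u : ℕ → A) : Prop where
  comul_apply : ∀ n, H.comul (u n) = ∑ j ∈ Finset.range (n + 1), ∑ i ∈ Finset.range (n - j + 1),
    (-lam) ^ j • (u i ⊗ₜ[R] u (n - j - i))
  counit_zero : H.counit (u 0) = 1
  counit_one : H.counit (u 1) = lam
  counit_add_two : ∀ n, H.counit (u (n + 2)) = 0

/-- The coalgebra structure of the quasi-shuffle Hopf algebra: the deconcatenation coproduct
`Δ w = ∑_{uv = w} u ⊗ v` and the counit with `ε w = 0` for every nonempty word `w`. -/
structure IsDeconcatenation {R A : Type*} [CommRing R] [NonUnitalCommRing A] [Module R A]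
    [IsScalarTower R A A] [SMulCommClass R A A] {lam : R}
    (H : HopfStructure R (ShPlus R A lam)) : Prop where
  comul_word : ∀ l : List A, H.comul (ShPlus.word l) =
    ∑ i ∈ Finset.range (l.length + 1), ShPlus.word (l.take i) ⊗ₜ[R] ShPlus.word (l.drop i)
  counit_word : ∀ l : List A, H.counit (ShPlus.word l) = if l = [] then 1 else 0

/-! ### Hoffman sets and the algebras they generate -/

/-- A Hoffman set: a locally finite set `X`, i.e. the disjoint union of finite sets
`Xₙ = {x | deg x = n}`, `n ≥ 1`, with a commutative and associative pairing on `X ∪ {0}` for which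
`0` is absorbing and which either vanishes identically or is additive on degrees. Here `X ∪ {0}` is
`Option X`, and `0` is `none`. As usual, `0` is homogeneous of every degree, so additivity on degrees
restricts only those brackets of letters that are again letters. -/
class HoffmanSet (X : Type*) where
  deg : X → ℕ
  one_le_deg : ∀ x, 1 ≤ deg x
  finite_deg : ∀ n, {x | deg x = n}.Finite
  bracket : Option X → Option X → Option X
  bracket_none : ∀ a, bracket a none = none
  bracket_comm : ∀ a b, bracket a b = bracket b a
  bracket_assoc : ∀ a b c, bracket (bracket a b) c = bracket a (bracket b c)
  bracket_deg : (∀ a b, bracket a b = none) ∨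
    ∀ a b c : X, bracket (some a) (some b) = some c → deg c = deg a + deg b

/-- The algebra `A = k{X}` generated by a Hoffman set `X`: the free `k`-module on `X` with the
bilinear extension of the bracket (not the pointwise product) as its product. -/
def HoffmanAlgebra (k X : Type*) [CommRing k] : Type _ := X →₀ k

namespace HoffmanAlgebra

variable {k X : Type*} [CommRing k]

instance : AddCommGroup (HoffmanAlgebra k X) := inferInstanceAs (AddCommGroup (X →₀ k))

instance : Module k (HoffmanAlgebra k X) := inferInstanceAs (Module k (X →₀ k))

/-- The image in `A` of an element of `X ∪ {0}`. -/
def letter : Option X → HoffmanAlgebra k X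
  | none => 0
  | some x => (Finsupp.single x 1 : X →₀ k)

/-- The `k`-linear map on `A` with prescribed values on the letters. -/
def lift {M : Type*} [AddCommGroup M] [Module k M] (f : X → M) : HoffmanAlgebra k X →ₗ[k] M :=
  (Finsupp.linearCombination k f : (X →₀ k) →ₗ[k] M)

theorem lift_letter {M : Type*} [AddCommGroup M] [Module k M] (f : X → M) (x : X) :
    lift f (letter (some x) : HoffmanAlgebra k X) = f x :=
  (Finsupp.linearCombination_single k (1 : k) x).trans (one_smul k _)

theorem induction {P : HoffmanAlgebra k X → Prop} (zero : P 0)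
    (letter : ∀ x : X, P (letter (some x))) (add : ∀ u v, P u → P v → P (u + v))
    (smul : ∀ (r : k) u, P u → P (r • u)) (u : HoffmanAlgebra k X) : P u := by
  refine Finsupp.induction_linear (motive := P) u zero add (fun x r => ?_)
  have h : (Finsupp.single x r : X →₀ k) = r • (Finsupp.single x 1 : X →₀ k) := by simp
  rw [h]
  exact smul r _ (letter x)

variable [HoffmanSet X]

/-- The bilinear extension of the bracket. -/
def mulₗ : HoffmanAlgebra k X →ₗ[k] HoffmanAlgebra k X →ₗ[k] HoffmanAlgebra k X :=
  lift fun a => lift fun b => letter (HoffmanSet.bracket (some a) (some b))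

theorem mulₗ_letter (a b : Option X) :
    mulₗ (letter a : HoffmanAlgebra k X) (letter b) = letter (HoffmanSet.bracket a b) := by
  cases a with
  | none => rw [HoffmanSet.bracket_comm, HoffmanSet.bracket_none]; simp [letter]
  | some a =>
    cases b with
    | none => rw [HoffmanSet.bracket_none]; simp [letter]
    | some b => rw [mulₗ, lift_letter, lift_letter]

theorem mulₗ_comm (u v : HoffmanAlgebra k X) : mulₗ u v = mulₗ v u := by
  induction u using induction with
  | zero => simp
  | letter a =>
    induction v using induction with
    | zero => simp
    | letter b => rw [mulₗ_letter, mulₗ_letter, HoffmanSet.bracket_comm]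
    | add v w hv hw => simp only [map_add, LinearMap.add_apply, hv, hw]
    | smul r v hv => simp only [map_smul, LinearMap.smul_apply, hv]
  | add v w hv hw => simp only [map_add, LinearMap.add_apply, hv, hw]
  | smul r v hv => simp only [map_smul, LinearMap.smul_apply, hv]

theorem mulₗ_assoc (u v w : HoffmanAlgebra k X) : mulₗ (mulₗ u v) w = mulₗ u (mulₗ v w) := by
  induction u using induction with
  | zero => simp
  | letter a =>
    induction v using induction with
    | zero => simp
    | letter b =>
      induction w using induction with
      | zero => simp
      | letter c => simp only [mulₗ_letter, HoffmanSet.bracket_assoc]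
      | add v w hv hw => simp only [map_add, hv, hw]
      | smul r v hv => simp only [map_smul, hv]
    | add v w hv hw => simp only [map_add, LinearMap.add_apply, hv, hw]
    | smul r v hv => simp only [map_smul, LinearMap.smul_apply, hv]
  | add v w hv hw => simp only [map_add, LinearMap.add_apply, hv, hw]
  | smul r v hv => simp only [map_smul, LinearMap.smul_apply, hv]

instance : Mul (HoffmanAlgebra k X) := ⟨fun u v => mulₗ u v⟩

theorem mul_def (u v : HoffmanAlgebra k X) : u * v = mulₗ u v := rfl

instance : NonUnitalCommRing (HoffmanAlgebra k X) :=
  { (inferInstance : AddCommGroup (HoffmanAlgebra k X)),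
    (inferInstance : Mul (HoffmanAlgebra k X)) with
    left_distrib := fun u v w => by simp [mul_def]
    right_distrib := fun u v w => by simp [mul_def]
    zero_mul := fun u => by simp [mul_def]
    mul_zero := fun u => by simp [mul_def]
    mul_assoc := mulₗ_assoc
    mul_comm := mulₗ_comm }

instance : IsScalarTower k (HoffmanAlgebra k X) (HoffmanAlgebra k X) :=
  ⟨fun r u v => by simp [mul_def]⟩

instance : SMulCommClass k (HoffmanAlgebra k X) (HoffmanAlgebra k X) :=
  ⟨fun r u v => by simp [mul_def]⟩

end HoffmanAlgebra

section Factors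

variable (k X : Type*) [CommRing k] [HoffmanSet X] (lam : k)

/-- The unitary algebra `Ã = k ⊕ A` generated by `X`. -/
abbrev UnitalHoffmanAlgebra : Type _ := Unitization k (HoffmanAlgebra k X)

/-- The embedding `Ш⁺(A) → Ш⁺(Ã)` induced by `A ⊆ Ã`. -/
def inclPlus : ShPlus k (HoffmanAlgebra k X) lam →ₐ[k] ShPlus k (UnitalHoffmanAlgebra k X) lam :=
  ShPlus.map (Unitization.inrNonUnitalAlgHom k (HoffmanAlgebra k X))

/-- The embedding `Ш⁺(A) → Ш(Ã)`, `a ↦ 1_A ⊗ a`, with image `1_A ⊗ Ш⁺(A)`. -/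
def incl : ShPlus k (HoffmanAlgebra k X) lam →ₐ[k] Sh k (UnitalHoffmanAlgebra k X) lam :=
  Algebra.TensorProduct.includeRight.comp (inclPlus k X lam)

end Factors

end MixableShuffle

end

/-! Both products of subalgebras turn out to be tensor products. If `f : A₁ → B` and `g : A₂ → B`
are homomorphisms of commutative algebras for which `a ⊗ b ↦ f a * g b` is injective, then the
subalgebra generated by the two images is a copy of `A₁ ⊗ A₂`. The tensor product Hopf structure
moves there and restricts to the given ones on the factors (`exists_expands`). What remains is to
build the two Hopf algebras and to prove that injectivity.

Quasi-shuffle side: coproduct and counit are defined by recursion on the first letter, and the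
bialgebra axioms follow by induction on words. The antipode is a convolution inverse of the
identity, obtained by solving the equation `id * S = η ∘ ε` letter by letter.

Divided power side: in characteristic zero `uₙ = u₁ (u₁ - λ) ⋯ (u₁ - (n - 1) λ) / n!`, so `Ш⁺(k)` is
the polynomial algebra in `u₁`. The structure is the one in which `u₁ - λ` is primitive. The
explicit formula for `Δ uₙ` is recovered by recursion (`onePowComul_eq`): formally `∑ uₙ tⁿ = (1 + λ
t)^(u₁ / λ)`, and `Δ` sends this series to `(1 + λ t)^(x + y - 1)`, where `λ x = u₁ ⊗ 1` and `λ y =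
1 ⊗ u₁`.

Independence: the projection `φ : Ã → k` kills `A` and fixes the unit. Deleting the first letter
through `φ` sends `(1 ⊗ v) ⋄ w` to `v ⋄ w` and `w` to `0` for `w` in `Ш⁺(A)`, so a relation `∑ 1^{⊗
n} ⋄ wₙ = 0` can be shortened until all `wₙ` vanish (`eq_zero_of_sum_word_mul_map_eq_zero`). The
statement for `Ш` reduces to that for `Ш⁺`, since the front factor of `Ш(k)` contains only scalars
(`gamma_eq`). -/

noncomputable section

namespace MixableShuffle

/-! ### Constructions of Hopf algebra structures -/

namespace HopfStructure

variable {R A B : Type*} [CommRing R] [Ring A] [Ring B]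

/-- The Hopf structure underlying a Mathlib Hopf algebra. -/
def ofHopfAlgebra (R A : Type*) [CommRing R] [Ring A] [HopfAlgebra R A] : HopfStructure R A where
  comul := Coalgebra.comul
  counit := Coalgebra.counit
  coassoc := Coalgebra.coassoc
  rTensor_counit_comp_comul := Coalgebra.rTensor_counit_comp_comul
  lTensor_counit_comp_comul := Coalgebra.lTensor_counit_comp_comul
  counit_one := Bialgebra.counit_one
  counit_mul := Bialgebra.counit_mul
  comul_one := Bialgebra.comul_one
  comul_mul := Bialgebra.comul_mul
  antipode := HopfAlgebra.antipode R
  mul_antipode_rTensor_comul := HopfAlgebra.mul_antipode_rTensor_comul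
  mul_antipode_lTensor_comul := HopfAlgebra.mul_antipode_lTensor_comul

variable [Algebra R A] [Algebra R B]

/-- The tensor product of two Hopf structures. -/
def tensor (H : HopfStructure R A) (K : HopfStructure R B) : HopfStructure R (A ⊗[R] B) :=
  letI := H.toHopfAlgebra
  letI := K.toHopfAlgebra
  ofHopfAlgebra R (A ⊗[R] B)

/-- The unit of the other factor is grouplike, with counit and antipode equal to `1`, so it
contributes nothing to any of the three maps. -/
theorem isHopfHom_includeLeft (H : HopfStructure R A) (K : HopfStructure R B) :
    IsHopfHom H (H.tensor K) (Algebra.TensorProduct.includeLeft : A →ₐ[R] A ⊗[R] B) := by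
  let := H.toHopfAlgebra
  let := K.toHopfAlgebra
  refine ⟨fun a => ?_, fun a => ?_, fun a => ?_⟩
  · change Coalgebra.comul (R := R) (a ⊗ₜ[R] (1 : B)) =
      TensorProduct.map _ _ (Coalgebra.comul (R := R) a)
    rw [TensorProduct.comul_tmul, Bialgebra.comul_one]
    induction Coalgebra.comul (R := R) a with
    | zero => simp
    | add x y hx hy => rw [map_add, ← hx, ← hy, TensorProduct.add_tmul, map_add]
    | tmul x y => rfl
  · change Coalgebra.counit (R := R) (a ⊗ₜ[R] (1 : B)) = Coalgebra.counit (R := R) a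
    rw [TensorProduct.counit_tmul, Bialgebra.counit_one, one_smul]
  · change HopfAlgebra.antipode R a ⊗ₜ[R] HopfAlgebra.antipode R (1 : B) = _
    rw [HopfAlgebra.antipode_one]
    rfl

theorem isHopfHom_includeRight (H : HopfStructure R A) (K : HopfStructure R B) :
    IsHopfHom K (H.tensor K) (Algebra.TensorProduct.includeRight : B →ₐ[R] A ⊗[R] B) := by
  let := H.toHopfAlgebra
  let := K.toHopfAlgebra
  refine ⟨fun a => ?_, fun a => ?_, fun a => ?_⟩
  · change Coalgebra.comul (R := R) ((1 : A) ⊗ₜ[R] a) =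
      TensorProduct.map _ _ (Coalgebra.comul (R := R) a)
    rw [TensorProduct.comul_tmul, Bialgebra.comul_one]
    induction Coalgebra.comul (R := R) a with
    | zero => simp
    | add x y hx hy => rw [map_add, ← hx, ← hy, TensorProduct.tmul_add, map_add]
    | tmul x y => rfl
  · change Coalgebra.counit (R := R) ((1 : A) ⊗ₜ[R] a) = Coalgebra.counit (R := R) a
    rw [TensorProduct.counit_tmul, Bialgebra.counit_one, smul_eq_mul, mul_one]
  · change HopfAlgebra.antipode R (1 : A) ⊗ₜ[R] HopfAlgebra.antipode R a = _
    rw [HopfAlgebra.antipode_one]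
    rfl

/-- Transport of a Hopf structure along an isomorphism of algebras. -/
def transport (H : HopfStructure R A) (e : A ≃ₐ[R] B) : HopfStructure R B where
  comul := TensorProduct.map e.toLinearMap e.toLinearMap ∘ₗ H.comul ∘ₗ e.symm.toLinearMap
  counit := H.counit ∘ₗ e.symm.toLinearMap
  coassoc := by
    ext b
    -- Coassociativity at `e.symm b`, pushed forward by `e ⊗ (e ⊗ e)`; each side is then compared
    -- with its transported form on pure tensors.
    have h := congrArg (TensorProduct.map e.toLinearMap
      (TensorProduct.map e.toLinearMap e.toLinearMap)) (LinearMap.congr_fun H.coassoc (e.symm b))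
    simp only [LinearMap.comp_apply, LinearEquiv.coe_coe, AlgEquiv.toLinearMap_apply] at h ⊢
    convert h using 1
    · generalize H.comul (e.symm b) = z
      induction z with
      | zero => simp
      | add x y hx hy => simp only [map_add, hx, hy]
      | tmul x y =>
        simp only [TensorProduct.map_tmul, LinearMap.rTensor_tmul, LinearMap.comp_apply,
          AlgEquiv.toLinearMap_apply, AlgEquiv.symm_apply_apply]
        generalize H.comul x = w
        induction w with
        | zero => simp
        | add x y hx hy => simp only [map_add, TensorProduct.add_tmul, hx, hy]
        | tmul x y => simp
    · generalize H.comul (e.symm b) = z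
      induction z with
      | zero => simp
      | add x y hx hy => simp only [map_add, hx, hy]
      | tmul x y => simp
  rTensor_counit_comp_comul := by
    ext b
    have h := congrArg (LinearMap.lTensor R e.toLinearMap)
      (LinearMap.congr_fun H.rTensor_counit_comp_comul (e.symm b))
    simp only [LinearMap.comp_apply, AlgEquiv.toLinearMap_apply, TensorProduct.mk_apply,
      LinearMap.lTensor_tmul, AlgEquiv.apply_symm_apply] at h ⊢
    rw [← h]
    induction H.comul (e.symm b) with
    | zero => simp
    | add x y hx hy => simp only [map_add, hx, hy]
    | tmul x y => simp
  lTensor_counit_comp_comul := by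
    ext b
    have h := congrArg (LinearMap.rTensor R e.toLinearMap)
      (LinearMap.congr_fun H.lTensor_counit_comp_comul (e.symm b))
    simp only [LinearMap.comp_apply, AlgEquiv.toLinearMap_apply, LinearMap.flip_apply,
      TensorProduct.mk_apply, LinearMap.rTensor_tmul, AlgEquiv.apply_symm_apply] at h ⊢
    rw [← h]
    induction H.comul (e.symm b) with
    | zero => simp
    | add x y hx hy => simp only [map_add, hx, hy]
    | tmul x y => simp
  counit_one := by simp [H.counit_one]
  counit_mul a b := by simp [H.counit_mul]
  comul_one := by simp [H.comul_one, Algebra.TensorProduct.one_def]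
  comul_mul a b := by
    simp only [LinearMap.comp_apply, AlgEquiv.toLinearMap_apply, map_mul, H.comul_mul]
    exact map_mul (Algebra.TensorProduct.map (e : A →ₐ[R] B) (e : A →ₐ[R] B)) _ _
  antipode := e.toLinearMap ∘ₗ H.antipode ∘ₗ e.symm.toLinearMap
  mul_antipode_rTensor_comul := by
    ext b
    have h := congrArg e (LinearMap.congr_fun H.mul_antipode_rTensor_comul (e.symm b))
    simp only [LinearMap.comp_apply, AlgEquiv.toLinearMap_apply, Algebra.linearMap_apply,
      AlgEquiv.commutes] at h ⊢
    rw [← h]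
    induction H.comul (e.symm b) with
    | zero => simp
    | add x y hx hy => simp only [map_add, hx, hy]
    | tmul x y => simp
  mul_antipode_lTensor_comul := by
    ext b
    have h := congrArg e (LinearMap.congr_fun H.mul_antipode_lTensor_comul (e.symm b))
    simp only [LinearMap.comp_apply, AlgEquiv.toLinearMap_apply, Algebra.linearMap_apply,
      AlgEquiv.commutes] at h ⊢
    rw [← h]
    induction H.comul (e.symm b) with
    | zero => simp
    | add x y hx hy => simp only [map_add, hx, hy]
    | tmul x y => simp

theorem isHopfHom_transport (H : HopfStructure R A) (e : A ≃ₐ[R] B) :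
    IsHopfHom H (H.transport e) (e : A →ₐ[R] B) where
  map_comul a := congrArg (fun x => TensorProduct.map e.toLinearMap e.toLinearMap (H.comul x))
    (e.symm_apply_apply a)
  map_counit a := congrArg H.counit (e.symm_apply_apply a)
  map_antipode a := congrArg (fun x => e (H.antipode x)) (e.symm_apply_apply a)

end HopfStructure

theorem IsHopfHom.comp {R A B C : Type*} [CommRing R] [Ring A] [Ring B] [Ring C] [Algebra R A]
    [Algebra R B] [Algebra R C] {H : HopfStructure R A} {K : HopfStructure R B}
    {L : HopfStructure R C} {g : B →ₐ[R] C} {f : A →ₐ[R] B} (hg : IsHopfHom K L g)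
    (hf : IsHopfHom H K f) : IsHopfHom H L (g.comp f) where
  map_comul a := by
    rw [AlgHom.comp_apply, hg.map_comul, hf.map_comul, AlgHom.comp_toLinearMap,
      TensorProduct.map_comp, LinearMap.comp_apply]
  map_counit a := by rw [AlgHom.comp_apply, hg.map_counit, hf.map_counit]
  map_antipode a := by
    rw [AlgHom.comp_apply, hg.map_antipode, hf.map_antipode, AlgHom.comp_apply]

/-- If `a ⊗ b ↦ f a * g b` is injective, then the product of the images of `f` and `g` is
isomorphic to the tensor product, whose Hopf structure expands those of the factors. -/
theorem exists_expands {R A₁ A₂ B : Type*} [CommRing R] [CommRing A₁] [CommRing A₂] [CommRing B]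
    [Algebra R A₁] [Algebra R A₂] [Algebra R B] (f : A₁ →ₐ[R] B) (g : A₂ →ₐ[R] B)
    (H₁ : HopfStructure R A₁) (H₂ : HopfStructure R A₂)
    (hinj : Function.Injective (Algebra.TensorProduct.productMap f g)) :
    ∃ H : HopfStructure R (algProd f.range g.range), Expands f g H₁ H₂ H := by
  let e : A₁ ⊗[R] A₂ ≃ₐ[R] algProd f.range g.range :=
    (AlgEquiv.ofInjective _ hinj).trans
      (Subalgebra.equivOfEq _ _ (Algebra.TensorProduct.productMap_range f g))
  have hT := (H₁.tensor H₂).isHopfHom_transport e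
  refine ⟨(H₁.tensor H₂).transport e, ?_, ?_⟩
  · have h := hT.comp (H₁.isHopfHom_includeLeft H₂)
    have he : (e : A₁ ⊗[R] A₂ →ₐ[R] algProd f.range g.range).comp Algebra.TensorProduct.includeLeft =
        (Subalgebra.inclusion (le_sup_left : f.range ≤ algProd f.range g.range)).comp
          f.rangeRestrict := by
      refine AlgHom.ext fun a => Subtype.ext ?_
      change Algebra.TensorProduct.productMap f g (a ⊗ₜ 1) = f a
      simp
    rwa [he] at h
  · have h := hT.comp (H₁.isHopfHom_includeRight H₂)
    have he : (e : A₁ ⊗[R] A₂ →ₐ[R] algProd f.range g.range).comp Algebra.TensorProduct.includeRight =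
        (Subalgebra.inclusion (le_sup_right : g.range ≤ algProd f.range g.range)).comp
          g.rangeRestrict := by
      refine AlgHom.ext fun a => Subtype.ext ?_
      change Algebra.TensorProduct.productMap f g (1 ⊗ₜ a) = g a
      simp
    rwa [he] at h

/-! ### Recursion on words -/

namespace ShPlus

variable {R A : Type*} [CommRing R] [NonUnitalCommRing A] [Module R A] {lam : R}

theorem cons_add_left (a b : A) : (cons (a + b) : ShPlus R A lam →ₗ[R] _) = cons a + cons b := by
  ext u
  simp [cons, add_mul]

theorem cons_smul_left (r : R) (a : A) : (cons (r • a) : ShPlus R A lam →ₗ[R] _) = r • cons a := by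
  ext u
  simp [cons]

/-- Left concatenation, as a linear map in the letter. -/
def consₗ : A →ₗ[R] Module.End R (ShPlus R A lam) where
  toFun := cons
  map_add' := cons_add_left
  map_smul' := cons_smul_left

theorem consₗ_apply (a : A) : consₗ a = (cons a : ShPlus R A lam →ₗ[R] _) := rfl

section Recursion

variable {M : Type*} [AddCommGroup M] [Module R M]

/-- One step of the recursion for `wordRec`. -/
def wordRecStep (F : A →ₗ[R] ShPlus R A lam →ₗ[R] M) (G : A →ₗ[R] Module.End R M) :
    A →ₗ[R] Module.End R (ShPlus R A lam × M) :=
  LinearMap.mk₂ R (fun a p => (consₗ a p.1, F a p.1 + G a p.2))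
    (fun a b p => by ext <;> simp; abel)
    (fun r a p => by ext <;> simp)
    (fun a p q => by ext <;> simp; abel)
    (fun r a p => by ext <;> simp)

/-- The pair `(u, f u)`, where `f` is the linear map defined by `wordRec`. -/
def wordRecAux (m : M) (F : A →ₗ[R] ShPlus R A lam →ₗ[R] M) (G : A →ₗ[R] Module.End R M) :
    ShPlus R A lam →ₗ[R] ShPlus R A lam × M :=
  LinearMap.applyₗ (of (1 : TensorAlgebra R A), m) ∘ₗ
    (TensorAlgebra.lift R (wordRecStep F G)).toLinearMap ∘ₗ of.symm.toLinearMap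

theorem wordRecAux_cons (m : M) (F : A →ₗ[R] ShPlus R A lam →ₗ[R] M)
    (G : A →ₗ[R] Module.End R M) (a : A) (u : ShPlus R A lam) :
    wordRecAux m F G (cons a u) = (cons a (wordRecAux m F G u).1,
      F a (wordRecAux m F G u).1 + G a (wordRecAux m F G u).2) := by
  simp [wordRecAux, cons, wordRecStep, consₗ]

/-- The linear map `f` with `f 1 = m` and `f (a ⊗ u) = F a u + G a (f u)`. -/
def wordRec (m : M) (F : A →ₗ[R] ShPlus R A lam →ₗ[R] M) (G : A →ₗ[R] Module.End R M) :
    ShPlus R A lam →ₗ[R] M :=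
  LinearMap.snd R _ _ ∘ₗ wordRecAux m F G

theorem wordRec_one (m : M) (F : A →ₗ[R] ShPlus R A lam →ₗ[R] M) (G : A →ₗ[R] Module.End R M) :
    wordRec m F G 1 = m := by
  have h : of.symm (1 : ShPlus R A lam) = 1 := rfl
  simp [wordRec, wordRecAux, h]

end Recursion

variable [IsScalarTower R A A] [SMulCommClass R A A]

/-- Induction on words. -/
theorem induction {P : ShPlus R A lam → Prop} (one : P 1) (cons : ∀ a u, P u → P (cons a u))
    (add : ∀ u v, P u → P v → P (u + v)) (smul : ∀ (r : R) u, P u → P (r • u))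
    (u : ShPlus R A lam) : P u :=
  word_induction (P := fun u : TensorAlgebra R A => P (of u)) one (fun a u => cons a (of u))
    (fun u v => add (of u) (of v)) (fun r u => smul r (of u)) (of.symm u)

theorem hom_ext {M : Type*} [AddCommGroup M] [Module R M] {f g : ShPlus R A lam →ₗ[R] M}
    (one : f 1 = g 1) (cons : ∀ a u, f u = g u → f (cons a u) = g (cons a u)) : f = g := by
  ext u
  induction u using induction with
  | one => exact one
  | cons a u hu => exact cons a u hu
  | add u v hu hv => rw [map_add, map_add, hu, hv]
  | smul r u hu => rw [map_smul, map_smul, hu]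

theorem cons_mul_cons (a b : A) (u v : ShPlus R A lam) :
    cons a u * cons b v =
      cons a (u * cons b v) + cons b (cons a u * v) + lam • cons (a * b) (u * v) := by
  simp [cons, mul_def, mixShuffle_cons_cons]

section Recursion

variable {M : Type*} [AddCommGroup M] [Module R M] (m : M)
  (F : A →ₗ[R] ShPlus R A lam →ₗ[R] M) (G : A →ₗ[R] Module.End R M)

/-- The universal property of the tensor algebra gives recursion on the value only, whereas `F` also
needs the tail. Hence the tail is carried as a first component, which prefixing merely rebuilds. -/
theorem wordRecAux_fst (u : ShPlus R A lam) : (wordRecAux m F G u).1 = u := by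
  induction u using induction with
  | one => simp [wordRecAux, one_def]
  | cons a u hu => rw [wordRecAux_cons, hu]
  | add u v hu hv => rw [map_add, Prod.fst_add, hu, hv]
  | smul r u hu => rw [map_smul, Prod.smul_fst, hu]

theorem wordRec_cons (a : A) (u : ShPlus R A lam) :
    wordRec m F G (cons a u) = F a u + G a (wordRec m F G u) := by
  simp [wordRec, wordRecAux_cons, wordRecAux_fst]

end Recursion

/-! ### The quasi-shuffle Hopf algebra -/

variable (R A lam) in
/-- The counit, which vanishes on nonempty words. -/
def eps : ShPlus R A lam →ₗ[R] R := wordRec 1 0 0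

theorem eps_one : eps R A lam 1 = 1 := wordRec_one ..

theorem eps_cons (a : A) (u : ShPlus R A lam) : eps R A lam (cons a u) = 0 := by
  simp [eps, wordRec_cons]

/-- Concatenation of a letter to the left tensor factor. -/
def consLeft : A →ₗ[R] Module.End R (ShPlus R A lam ⊗[R] ShPlus R A lam) where
  toFun a := (cons a).rTensor (ShPlus R A lam)
  map_add' a b := by rw [cons_add_left, LinearMap.rTensor_add]
  map_smul' r a := by rw [cons_smul_left, LinearMap.rTensor_smul]; rfl

theorem consLeft_tmul (a : A) (u v : ShPlus R A lam) :
    consLeft a (u ⊗ₜ[R] v) = cons a u ⊗ₜ[R] v := rfl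

variable (R A lam) in
/-- The deconcatenation coproduct. -/
def deconcat : ShPlus R A lam →ₗ[R] ShPlus R A lam ⊗[R] ShPlus R A lam :=
  wordRec (1 ⊗ₜ 1) (consₗ.compr₂ (TensorProduct.mk R _ _ 1)) consLeft

theorem deconcat_one : deconcat R A lam 1 = 1 ⊗ₜ 1 := wordRec_one ..

theorem deconcat_cons (a : A) (u : ShPlus R A lam) :
    deconcat R A lam (cons a u) = 1 ⊗ₜ cons a u + consLeft a (deconcat R A lam u) := by
  rw [deconcat, wordRec_cons]
  rfl

theorem deconcat_word (l : List A) : deconcat R A lam (word l) =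
    ∑ i ∈ Finset.range (l.length + 1), word (l.take i) ⊗ₜ[R] word (l.drop i) := by
  induction l with
  | nil => simp [word_nil, deconcat_one]
  | cons a l hl =>
    -- The summand `i = 0`, the empty prefix, is the term `1 ⊗ cons a u`; the others have a prefix
    -- starting with `a`.
    rw [word_cons, deconcat_cons, hl, List.length_cons, Finset.sum_range_succ' _ (l.length + 1),
      add_comm, map_sum]
    simp [consLeft_tmul, word_cons, word_nil]

theorem tmul_mul_tmul (u v u' v' : ShPlus R A lam) :
    (u ⊗ₜ[R] v) * (u' ⊗ₜ[R] v') = (u * u') ⊗ₜ[R] (v * v') :=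
  Algebra.TensorProduct.tmul_mul_tmul u u' v v'

/-- Products are componentwise, so the shuffle recursion of the left factor survives tensoring with
the right one. -/
theorem consLeft_mul_consLeft (a b : A) (p q : ShPlus R A lam ⊗[R] ShPlus R A lam) :
    consLeft a p * consLeft b q =
      consLeft a (p * consLeft b q) + consLeft b (consLeft a p * q) +
        lam • consLeft (a * b) (p * q) := by
  induction p with
  | zero => simp
  | add p p' hp hp' => simp only [map_add, add_mul, hp, hp', smul_add]; abel
  | tmul u v =>
    induction q with
    | zero => simp
    | add q q' hq hq' => simp only [map_add, mul_add, hq, hq', smul_add]; abel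
    | tmul u' v' =>
      simp only [consLeft_tmul, tmul_mul_tmul, cons_mul_cons,
        TensorProduct.add_tmul, TensorProduct.smul_tmul']

theorem consLeft_mul_one_tmul (a : A) (p : ShPlus R A lam ⊗[R] ShPlus R A lam)
    (v : ShPlus R A lam) : consLeft a p * 1 ⊗ₜ v = consLeft a (p * 1 ⊗ₜ v) := by
  induction p with
  | zero => simp
  | add p p' hp hp' => simp only [map_add, add_mul, hp, hp']
  | tmul u w => simp [consLeft_tmul]

/-- Expanding both coproducts by `deconcat_cons` gives four products. The two unmixed ones follow
the shuffle recursion in the right and in the left factor; in the mixed ones the first letter on the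
left is already determined. Together they are the coproducts of the three terms of `cons_mul_cons`.
-/
theorem deconcat_mul (u v : ShPlus R A lam) :
    deconcat R A lam (u * v) = deconcat R A lam u * deconcat R A lam v := by
  induction u using induction generalizing v with
  | one => rw [one_mul, deconcat_one, ← Algebra.TensorProduct.one_def, one_mul]
  | cons a u hu =>
    induction v using induction with
    | one => rw [mul_one, deconcat_one, ← Algebra.TensorProduct.one_def, mul_one]
    | cons b v hv =>
      rw [cons_mul_cons]
      simp only [map_add, map_smul, deconcat_cons, hu, hv]
      simp only [add_mul, mul_add, consLeft_mul_consLeft, map_add, consLeft_mul_one_tmul,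
        mul_comm (1 ⊗ₜ[R] cons a u) (consLeft b _), tmul_mul_tmul,
        mul_one, smul_add, cons_mul_cons, TensorProduct.tmul_add, TensorProduct.tmul_smul,
        mul_comm (1 ⊗ₜ[R] cons a u) (deconcat R A lam v)]
      abel
    | add v w hv hw => simp only [map_add, mul_add, hv, hw]
    | smul r v hv => simp only [map_smul, mul_smul_comm, hv]
  | add u u' hu hu' => simp only [map_add, add_mul, hu, hu']
  | smul r u hu => simp only [map_smul, smul_mul_assoc, hu]

/-- A product of two nonempty words is a combination of nonempty words. -/
theorem eps_mul (u v : ShPlus R A lam) :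
    eps R A lam (u * v) = eps R A lam u * eps R A lam v := by
  induction u using induction generalizing v with
  | one => rw [one_mul, eps_one, one_mul]
  | cons a u hu =>
    induction v using induction with
    | one => rw [mul_one, eps_one, mul_one]
    | cons b v hv => simp [cons_mul_cons, eps_cons]
    | add v w hv hw => simp only [map_add, mul_add, hv, hw]
    | smul r v hv => simp only [map_smul, mul_smul_comm, hv]
  | add u u' hu hu' => simp only [map_add, add_mul, hu, hu']
  | smul r u hu => simp only [map_smul, smul_mul_assoc, hu]

variable (R A lam) in
/-- The coalgebra structure of the quasi-shuffle Hopf algebra. -/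
abbrev deconcatCoalgebra : Coalgebra R (ShPlus R A lam) where
  comul := deconcat R A lam
  counit := eps R A lam
  coassoc := by
    refine hom_ext ?_ fun a u hu => ?_
    · simp [deconcat_one]
    · simp only [LinearMap.comp_apply, LinearEquiv.coe_coe, deconcat_cons, map_add,
        LinearMap.rTensor_tmul, LinearMap.lTensor_tmul, deconcat_one, TensorProduct.assoc_tmul,
        TensorProduct.tmul_add] at hu ⊢
      rw [add_assoc]
      congr 1
      have h₁ : ∀ z, LinearMap.lTensor (ShPlus R A lam) (deconcat R A lam) (consLeft a z) =
          (cons a).rTensor _ (LinearMap.lTensor (ShPlus R A lam) (deconcat R A lam) z) := by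
        intro z
        induction z with
        | zero => simp only [LinearMap.map_zero]
        | add x y hx hy => simp only [map_add, hx, hy]
        | tmul x y => simp [consLeft_tmul]
      -- Unlike in `h₁`, the letter `a` now lies in the factor that is split again, so the cut in
      -- front of `a` gives an extra term.
      have h₂ : ∀ z, TensorProduct.assoc R _ _ _
            (LinearMap.rTensor (ShPlus R A lam) (deconcat R A lam) (consLeft a z)) =
          1 ⊗ₜ consLeft a z + (cons a).rTensor _ (TensorProduct.assoc R _ _ _
            (LinearMap.rTensor (ShPlus R A lam) (deconcat R A lam) z)) := by
        intro z
        induction z with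
        | zero => simp only [LinearMap.map_zero, LinearEquiv.map_zero, TensorProduct.tmul_zero,
          add_zero]
        | add x y hx hy => simp only [map_add, hx, hy, TensorProduct.tmul_add]; abel
        | tmul x y =>
          simp only [consLeft_tmul, LinearMap.rTensor_tmul, deconcat_cons, TensorProduct.add_tmul,
            map_add, TensorProduct.assoc_tmul]
          congr 1
          generalize deconcat R A lam x = w
          induction w with
          | zero => simp only [LinearMap.map_zero, LinearEquiv.map_zero, TensorProduct.zero_tmul]
          | add x y hx hy => simp only [map_add, TensorProduct.add_tmul, hx, hy]
          | tmul x y => simp [consLeft_tmul]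
      rw [h₁, h₂, hu]
  rTensor_counit_comp_comul := by
    refine hom_ext ?_ fun a u _ => ?_
    · simp [deconcat_one, eps_one]
    · have h : ∀ z, (eps R A lam).rTensor (ShPlus R A lam) (consLeft a z) = 0 := by
        intro z
        induction z with
        | zero => simp
        | add x y hx hy => simp only [map_add, hx, hy, add_zero]
        | tmul x y => simp [consLeft_tmul, eps_cons]
      simp [deconcat_cons, eps_one, h]
  lTensor_counit_comp_comul := by
    refine hom_ext ?_ fun a u hu => ?_
    · simp [deconcat_one, eps_one]
    · have h : ∀ z, (eps R A lam).lTensor (ShPlus R A lam) (consLeft a z) =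
          (cons a).rTensor R ((eps R A lam).lTensor (ShPlus R A lam) z) := by
        intro z
        induction z with
        | zero => simp
        | add x y hx hy => simp only [map_add, hx, hy]
        | tmul x y => simp [consLeft_tmul]
      rw [LinearMap.comp_apply] at hu
      simp [deconcat_cons, eps_cons, h, hu]

/-! ### The antipode of the quasi-shuffle algebra as a convolution inverse -/

/-- For a linear map `f`, the linear map `u ↦ (g ↦ (g * h) u)`, where `h` is the right convolution
inverse of `f`. -/
def convRec (f : Module.End R (ShPlus R A lam)) :
    ShPlus R A lam →ₗ[R] Module.End R (ShPlus R A lam) →ₗ[R] ShPlus R A lam :=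
  wordRec (LinearMap.applyₗ 1) 0
    (LinearMap.mk₂ R
      -- By `deconcat_cons`, `(g * h)(a ⊗ u) = g 1 * h (a ⊗ u) + ((g ∘ cons a) * h) u`. The case `g
      -- = f`, `f 1 = 1` forces `h (a ⊗ u) = -((f ∘ cons a) * h) u`. Since `g` changes in the
      -- recursion, the value at `u` is kept as a function of `g`.
      (fun a K => K ∘ₗ LinearMap.lcomp R _ (cons a) -
        (LinearMap.mulRight R (K (f ∘ₗ cons a))) ∘ₗ LinearMap.applyₗ 1)
      (fun a b K => by
        ext g; simp [cons_add_left, LinearMap.comp_add, LinearMap.lcomp_apply', mul_add]; abel)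
      (fun r a K => by
        ext g; simp [cons_smul_left, LinearMap.comp_smul, LinearMap.lcomp_apply', smul_sub])
      (fun a K K' => by ext g; simp [mul_add]; abel)
      (fun r a K => by ext g; simp [smul_sub]))

theorem convRec_one (f g : Module.End R (ShPlus R A lam)) : convRec f 1 g = g 1 := by
  rw [convRec, wordRec_one]
  rfl

theorem convRec_cons (f g : Module.End R (ShPlus R A lam)) (a : A) (u : ShPlus R A lam) :
    convRec f (cons a u) g =
      convRec f u (g ∘ₗ cons a) - g 1 * convRec f u (f ∘ₗ cons a) := by
  rw [convRec, wordRec_cons]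
  simp [LinearMap.lcomp_apply']

/-- The right convolution inverse of a linear map `f` with `f 1 = 1`. -/
def convInv (f : Module.End R (ShPlus R A lam)) : Module.End R (ShPlus R A lam) :=
  -- The convolution unit `η ∘ ε` is taken as `g`, since `(η ∘ ε) * h = h`.
  (convRec f).flip (Algebra.linearMap R _ ∘ₗ eps R A lam)

theorem convInv_one (f : Module.End R (ShPlus R A lam)) : convInv f 1 = 1 := by
  simp [convInv, convRec_one, eps_one]

theorem convInv_cons (f : Module.End R (ShPlus R A lam)) (a : A) (u : ShPlus R A lam) :
    convInv f (cons a u) = -convRec f u (f ∘ₗ cons a) := by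
  have h : (Algebra.linearMap R _ ∘ₗ eps R A lam) ∘ₗ cons a =
      (0 : Module.End R (ShPlus R A lam)) := by
    ext v
    simp [eps_cons]
  rw [convInv, LinearMap.flip_apply, convRec_cons, h]
  simp [eps_one]

/-- This confirms that the recursion computes an honest convolution with `convInv f`. The induction
must be uniform in `g`, because prefixing by `a` replaces `g` by `g ∘ cons a`. -/
theorem convRec_eq (f g : Module.End R (ShPlus R A lam)) (u : ShPlus R A lam) :
    convRec f u g =
      LinearMap.mul' R _ (TensorProduct.map g (convInv f) (deconcat R A lam u)) := by
  induction u using induction generalizing g with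
  | one => simp [convRec_one, deconcat_one, convInv_one]
  | cons a u hu =>
    have h : ∀ z, TensorProduct.map g (convInv f) (consLeft a z) =
        TensorProduct.map (g ∘ₗ cons a) (convInv f) z := by
      intro z
      induction z with
      | zero => simp
      | add x y hx hy => simp only [map_add, hx, hy]
      | tmul x y => simp [consLeft_tmul]
    rw [deconcat_cons, map_add, map_add, h, ← hu, convRec_cons, TensorProduct.map_tmul,
      LinearMap.mul'_apply, convInv_cons]
    ring
  | add u v hu hv => simp only [map_add, LinearMap.add_apply, hu, hv]
  | smul r u hu => simp only [map_smul, LinearMap.smul_apply, hu]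

theorem mul_map_convInv_deconcat {f : Module.End R (ShPlus R A lam)} (hf : f 1 = 1) :
    LinearMap.mul' R _ ∘ₗ TensorProduct.map f (convInv f) ∘ₗ deconcat R A lam =
      Algebra.linearMap R _ ∘ₗ eps R A lam := by
  ext u
  simp only [LinearMap.comp_apply]
  rw [← convRec_eq]
  induction u using induction with
  | one => simp [convRec_one, hf, eps_one]
  | cons a u _ => simp [convRec_cons, hf, eps_cons]
  | add u v hu hv => simp only [map_add, LinearMap.add_apply, hu, hv]
  | smul r u hu => simp only [map_smul, LinearMap.smul_apply, hu]

/-- Every linear map fixing `1` has a right convolution inverse. This applies to `id`, with inverse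
`S`, and again to `S`, since `S 1 = 1`. In a monoid `id * S = 1` and `S * T = 1` force `T = id`, so
`S` is a two-sided inverse. -/
theorem mul_map_convInv_id_deconcat :
    LinearMap.mul' R _ ∘ₗ TensorProduct.map (convInv LinearMap.id) LinearMap.id ∘ₗ
      deconcat R A lam = Algebra.linearMap R _ ∘ₗ eps R A lam := by
  let := deconcatCoalgebra R A lam
  let S : Module.End R (ShPlus R A lam) := convInv LinearMap.id
  have h₁ : WithConv.toConv (LinearMap.id : Module.End R (ShPlus R A lam)) *
      WithConv.toConv S = 1 :=
    congrArg WithConv.toConv (mul_map_convInv_deconcat (f := LinearMap.id) rfl)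
  have h₂ : WithConv.toConv S * WithConv.toConv (convInv S) = 1 :=
    congrArg WithConv.toConv (mul_map_convInv_deconcat (f := S) (convInv_one _))
  have h₃ := left_inv_eq_right_inv h₁ h₂
  rw [← h₃] at h₂
  exact congrArg WithConv.ofConv h₂

variable (R A lam) in
/-- The quasi-shuffle Hopf algebra. -/
def quasiShuffle : HopfStructure R (ShPlus R A lam) where
  toCoalgebra := deconcatCoalgebra R A lam
  counit_one := eps_one
  counit_mul := eps_mul
  comul_one := deconcat_one
  comul_mul := deconcat_mul
  antipode := convInv LinearMap.id
  mul_antipode_rTensor_comul := mul_map_convInv_id_deconcat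
  mul_antipode_lTensor_comul := mul_map_convInv_deconcat rfl

theorem isDeconcatenation_quasiShuffle : IsDeconcatenation (quasiShuffle R A lam) where
  comul_word := deconcat_word
  counit_word l := by
    cases l with
    | nil => exact eps_one
    | cons a l => exact (congrArg _ (word_cons a l)).trans (eps_cons a _)

end ShPlus

/-! ### The divided power Hopf algebra -/

section DividedPower

variable {R : Type*} [CommRing R] {lam : R}

theorem onePow_zero : onePow lam 0 = 1 := rfl

theorem onePow_succ (n : ℕ) : onePow lam (n + 1) = ShPlus.cons 1 (onePow lam n) :=
  ShPlus.word_cons 1 _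

/-- The powers `1^{⊗ n}` span. -/
theorem onePow_induction {P : ShPlus R R lam → Prop} (onePow : ∀ n, P (onePow lam n))
    (add : ∀ u v, P u → P v → P (u + v)) (smul : ∀ (r : R) u, P u → P (r • u))
    (u : ShPlus R R lam) : P u := by
  have h : u ∈ Submodule.span R (Set.range (MixableShuffle.onePow lam)) := by
    induction u using ShPlus.induction with
    | one => exact Submodule.subset_span ⟨0, rfl⟩
    | cons a u hu =>
      -- Every letter is a scalar multiple of the letter `1`.
      rw [← mul_one a, ← smul_eq_mul, ShPlus.cons_smul_left]
      refine Submodule.smul_mem _ a ?_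
      refine Submodule.span_le (p := (Submodule.span R
        (Set.range (MixableShuffle.onePow lam))).comap (ShPlus.cons 1)) |>.2 ?_ hu
      rintro _ ⟨n, rfl⟩
      exact Submodule.subset_span ⟨n + 1, onePow_succ n⟩
    | add u v hu hv => exact add_mem hu hv
    | smul r u hu => exact Submodule.smul_mem _ r hu
  induction h using Submodule.span_induction with
  | mem x hx =>
    obtain ⟨n, rfl⟩ := hx
    exact onePow n
  | zero => simpa using smul 0 _ (onePow 0)
  | add u v _ _ hu hv => exact add u v hu hv
  | smul r u _ hu => exact smul r u hu

/-- The relation that makes `u₁` a generator: an extra letter `1` can be inserted in `n + 1` places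
or merged, with weight `λ`, into one of the `n` letters. -/
theorem onePow_one_mul (n : ℕ) : onePow lam 1 * onePow lam n =
    ((n : R) + 1) • onePow lam (n + 1) + (n * lam) • onePow lam n := by
  induction n with
  | zero => simp [onePow_zero]
  | succ n ih =>
    rw [onePow_succ n, onePow_succ 0, ShPlus.cons_mul_cons, ← onePow_succ 0, ← onePow_succ n,
      onePow_zero, one_mul, one_mul, ih, map_add, map_smul, map_smul, ← onePow_succ,
      ← onePow_succ, one_mul, ← onePow_succ]
    push_cast
    module

/-- The linear map on `Ш⁺(R)` with prescribed values on the powers `1^{⊗ n}`. -/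
def onePowLift {M : Type*} [AddCommGroup M] [Module R M] (z : ℕ → M) : ShPlus R R lam →ₗ[R] M :=
  -- The recursion runs in sequences in `M`: prefixing by `1` shifts the sequence, and the entry at
  -- `0` is read off at the end.
  LinearMap.proj 0 ∘ₗ ShPlus.wordRec z 0
    (LinearMap.toSpanSingleton R _ (LinearMap.funLeft R M Nat.succ))

theorem onePowLift_onePow {M : Type*} [AddCommGroup M] [Module R M] (z : ℕ → M) (n : ℕ) :
    onePowLift z (onePow lam n) = z n := by
  have h : ∀ n m, ShPlus.wordRec z 0
      (LinearMap.toSpanSingleton R _ (LinearMap.funLeft R M Nat.succ)) (onePow lam n) m =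
        z (m + n) := by
    intro n
    induction n with
    | zero => intro m; rw [onePow_zero, ShPlus.wordRec_one, add_zero]
    | succ n ih =>
      intro m
      rw [onePow_succ, ShPlus.wordRec_cons]
      simp [LinearMap.funLeft_apply, ih, add_comm, add_left_comm]
  exact (h n 0).trans (by rw [zero_add])

end DividedPower

/-! ### The recursions for powers of the unit and for their coproducts -/

section Field

variable {k : Type*} [Field k] {lam : k} {B : Type*} [CommRing B] [Algebra k B]

theorem smul_onePow_succ (n : ℕ) : ((n : k) + 1) • onePow lam (n + 1) =
    (onePow lam 1 - algebraMap k _ (n * lam)) * onePow lam n := by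
  rw [sub_mul, onePow_one_mul, ← Algebra.smul_def]
  abel

/-- In generating series, `E(t) = (1 + λ t)^(w / λ)` and `D(t) = E(t) / (1 + λ t)`, so passing from
`E` to `D` replaces `w` by `w - λ`. The induction avoids dividing by `λ`. -/
theorem smul_succ_of_mul_eq {k : Type*} [Field k] {lam : k} {B : Type*} [CommRing B] [Algebra k B]
    {w : B} {E D : ℕ → B} (hE₀ : E 0 = 1) (hD₀ : D 0 = 1)
    (hE : ∀ n : ℕ, w * E n = ((n : k) + 1) • E (n + 1) + (n * lam) • E n)
    (hD : ∀ n, D (n + 1) = E (n + 1) - lam • D n) (n : ℕ) :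
    ((n : k) + 1) • D (n + 1) = (w - algebraMap k B lam - algebraMap k B (n * lam)) * D n := by
  simp only [Algebra.smul_def, map_add, map_mul, map_natCast, map_one] at *
  induction n with
  | zero =>
    have h := hE 0
    rw [hD 0, hD₀]
    rw [hE₀] at h
    push_cast at h ⊢
    linear_combination -h
  | succ n ih =>
    have h := hE (n + 1)
    push_cast at h ⊢
    -- `hD` eliminates both occurrences of `E` in favour of `D`; the remainder is `λ` times the
    -- induction hypothesis.
    linear_combination (n + 2 : B) * hD (n + 1) - h +
      ((n + 1) * algebraMap k B lam - w) * hD n - algebraMap k B lam * ih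

/-- `∑ᵢ uᵢ ⊗ u_{n - i}`. -/
def onePowConv (lam : k) (n : ℕ) : ShPlus k k lam ⊗[k] ShPlus k k lam :=
  ∑ p ∈ Finset.HasAntidiagonal.antidiagonal n, onePow lam p.1 ⊗ₜ onePow lam p.2

/-- The coproduct of `1^{⊗ n}`. -/
def onePowComul (lam : k) (n : ℕ) : ShPlus k k lam ⊗[k] ShPlus k k lam :=
  ∑ j ∈ Finset.range (n + 1), (-lam) ^ j • onePowConv lam (n - j)

/-- A Vandermonde identity: the convolution satisfies the recursion of `onePow_one_mul` with `u₁ ⊗ 1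
+ 1 ⊗ u₁` in place of `u₁`, as for a product of two binomial series. -/
theorem mul_onePowConv (n : ℕ) :
    (onePow lam 1 ⊗ₜ 1 + 1 ⊗ₜ onePow lam 1) * onePowConv lam n =
      ((n : k) + 1) • onePowConv lam (n + 1) + (n * lam) • onePowConv lam n := by
  have h₁ : ((n : k) + 1) • onePowConv lam (n + 1) =
      ∑ p ∈ Finset.HasAntidiagonal.antidiagonal n, (((p.1 : k) + 1) • (onePow lam (p.1 + 1) ⊗ₜ onePow lam p.2) +
        ((p.2 : k) + 1) • (onePow lam p.1 ⊗ₜ onePow lam (p.2 + 1))) := by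
    -- Split `n + 1 = p.1 + p.2`; in each half the end term has coefficient `0`, so the sum
    -- reindexes over the antidiagonal of `n`.
    have h : ((n : k) + 1) • onePowConv lam (n + 1) = ∑ p ∈ Finset.HasAntidiagonal.antidiagonal (n + 1),
        ((p.1 : k) • (onePow lam p.1 ⊗ₜ[k] onePow lam p.2) +
          (p.2 : k) • (onePow lam p.1 ⊗ₜ[k] onePow lam p.2)) := by
      rw [onePowConv, Finset.smul_sum]
      refine Finset.sum_congr rfl fun p hp => ?_
      rw [← add_smul, ← Nat.cast_add, Finset.HasAntidiagonal.mem_antidiagonal.1 hp, Nat.cast_succ]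
    rw [h, Finset.sum_add_distrib, Finset.sum_add_distrib, Finset.Nat.sum_antidiagonal_succ]
    congr 1
    · simp
    · rw [Finset.Nat.sum_antidiagonal_succ']
      simp
  rw [h₁, onePowConv, Finset.mul_sum, Finset.smul_sum, ← Finset.sum_add_distrib]
  refine Finset.sum_congr rfl fun p hp => ?_
  rw [add_mul, ShPlus.tmul_mul_tmul, ShPlus.tmul_mul_tmul, one_mul,
    one_mul, onePow_one_mul, onePow_one_mul, TensorProduct.add_tmul, TensorProduct.tmul_add,
    ← TensorProduct.smul_tmul', ← TensorProduct.smul_tmul', TensorProduct.tmul_smul,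
    TensorProduct.tmul_smul, ← Finset.HasAntidiagonal.mem_antidiagonal.1 hp]
  push_cast
  module

theorem onePowComul_succ (n : ℕ) :
    onePowComul lam (n + 1) = onePowConv lam (n + 1) - lam • onePowComul lam n := by
  rw [onePowComul, Finset.sum_range_succ', onePowComul, Finset.smul_sum, pow_zero, one_smul,
    Nat.sub_zero, sub_eq_add_neg, add_comm, ← Finset.sum_neg_distrib]
  congr 1
  refine Finset.sum_congr rfl fun j _ => ?_
  rw [Nat.add_sub_add_right, pow_succ']
  module

/-! ### The polynomial presentation and the Hopf structure in characteristic zero -/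

variable [CharZero k]

/-- The sequence `z (z - λ) ⋯ (z - (n - 1) λ) / n!`. -/
def dividedPowerSeq (lam : k) (z : B) : ℕ → B
  | 0 => 1
  | n + 1 => ((n : k) + 1)⁻¹ • ((z - algebraMap k B (n * lam)) * dividedPowerSeq lam z n)

theorem smul_dividedPowerSeq_succ (z : B) (n : ℕ) :
    ((n : k) + 1) • dividedPowerSeq lam z (n + 1) =
      (z - algebraMap k B (n * lam)) * dividedPowerSeq lam z n := by
  rw [dividedPowerSeq, smul_inv_smul₀ (Nat.cast_add_one_ne_zero n)]

theorem eq_dividedPowerSeq {z : B} {s : ℕ → B} (zero : s 0 = 1)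
    (succ : ∀ n : ℕ, ((n : k) + 1) • s (n + 1) = (z - algebraMap k B (n * lam)) * s n) (n : ℕ) :
    s n = dividedPowerSeq lam z n := by
  induction n with
  | zero => exact zero
  | succ n ih =>
    rw [dividedPowerSeq, ← ih, ← succ, inv_smul_smul₀ (Nat.cast_add_one_ne_zero n)]

/-- `Ш⁺(k)` is generated by `1_k`. -/
theorem dividedPower_algHom_ext {f g : ShPlus k k lam →ₐ[k] B}
    (h : f (onePow lam 1) = g (onePow lam 1)) : f = g := by
  have hn : ∀ (f : ShPlus k k lam →ₐ[k] B) n,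
      f (onePow lam n) = dividedPowerSeq lam (f (onePow lam 1)) n := by
    intro f
    refine eq_dividedPowerSeq (map_one f) fun n => ?_
    rw [← map_smul, smul_onePow_succ, map_mul, map_sub, AlgHom.commutes]
  ext u
  induction u using onePow_induction with
  | onePow n => rw [hn f, hn g, h]
  | add u v hu hv => rw [map_add, map_add, hu, hv]
  | smul r u hu => rw [map_smul, map_smul, hu]

/-- The universal property of `Ш⁺(k)`: it is a polynomial algebra in `1_k`. -/
def dividedPowerLift (lam : k) (z : B) : ShPlus k k lam →ₐ[k] B :=
  AlgHom.ofLinearMap (onePowLift (dividedPowerSeq lam z))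
    (by rw [← onePow_zero, onePowLift_onePow]; rfl)
    (by
      -- Multiplicativity is first shown for the left factor `u₁`, where it is the recursion for
      -- `dividedPowerSeq`.
      have h₁ : ∀ v, onePowLift (dividedPowerSeq lam z) (onePow lam 1 * v) =
          z * onePowLift (dividedPowerSeq lam z) v := by
        intro v
        induction v using onePow_induction with
        | onePow n =>
          rw [onePow_one_mul, map_add, map_smul, map_smul, onePowLift_onePow, onePowLift_onePow,
            smul_dividedPowerSeq_succ, sub_mul, Algebra.smul_def, sub_add_cancel]
        | add u v hu hv => simp only [map_add, mul_add, hu, hv]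
        | smul r u hu => simp only [map_smul, mul_smul_comm, hu]
      intro u v
      induction u using onePow_induction with
      | onePow n =>
        induction n with
        | zero => rw [onePow_zero, one_mul, ← onePow_zero, onePowLift_onePow, dividedPowerSeq,
            one_mul]
        | succ n ih =>
          -- After scaling by the invertible `n + 1`, the factor `uₙ₊₁` becomes `(u₁ - n λ) * uₙ`,
          -- which `h₁` and the induction hypothesis handle.
          refine smul_right_injective B (Nat.cast_add_one_ne_zero (R := k) n) ?_
          simp only
          rw [← map_smul, ← smul_mul_assoc, ← smul_mul_assoc, ← map_smul, smul_onePow_succ,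
            mul_assoc, sub_mul, sub_mul, map_sub, map_sub, h₁, h₁, ← Algebra.smul_def,
            ← Algebra.smul_def, map_smul, map_smul, ih, sub_mul, mul_assoc, smul_mul_assoc]
      | add u v hu hv => simp only [map_add, add_mul, hu, hv]
      | smul r u hu => simp only [map_smul, smul_mul_assoc, hu])

theorem dividedPowerLift_onePow (z : B) (n : ℕ) :
    dividedPowerLift lam z (onePow lam n) = dividedPowerSeq lam z n :=
  onePowLift_onePow _ n

theorem dividedPowerLift_onePow_one (z : B) : dividedPowerLift lam z (onePow lam 1) = z := by
  simp [dividedPowerLift_onePow, dividedPowerSeq]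

/-- The explicit double sum obeys the recursion of a divided power sequence, which determines it.
The shift by `-λ` is the effect of the alternating sum over `j`. -/
theorem onePowComul_eq (n : ℕ) : onePowComul lam n =
    dividedPowerSeq lam (onePow lam 1 ⊗ₜ 1 + 1 ⊗ₜ onePow lam 1 - lam • 1) n := by
  have h : onePowConv lam 0 = 1 := by
    simp [onePowConv, onePow_zero, Algebra.TensorProduct.one_def]
  have h' : onePowComul lam 0 = 1 := by
    simp [onePowComul, h]
  rw [← Algebra.algebraMap_eq_smul_one]
  exact eq_dividedPowerSeq h' (smul_succ_of_mul_eq h h' mul_onePowConv onePowComul_succ) n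

/-- The coproduct of the divided power Hopf algebra: `1_k - λ` is primitive. -/
def dividedPowerComul (lam : k) : ShPlus k k lam →ₐ[k] ShPlus k k lam ⊗[k] ShPlus k k lam :=
  dividedPowerLift lam (onePow lam 1 ⊗ₜ 1 + 1 ⊗ₜ onePow lam 1 - lam • 1)

theorem dividedPowerComul_onePow_one : dividedPowerComul lam (onePow lam 1) =
    onePow lam 1 ⊗ₜ 1 + 1 ⊗ₜ onePow lam 1 - lam • 1 :=
  dividedPowerLift_onePow_one _

/-- The bialgebra underlying the divided power Hopf algebra. -/
abbrev dividedPowerBialgebra (lam : k) : Bialgebra k (ShPlus k k lam) :=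
  -- The counit kills the primitive element `u₁ - λ`, hence sends `u₁` to `λ`. All axioms equate
  -- algebra homomorphisms, so they need checking only at `u₁`.
  Bialgebra.ofAlgHom (dividedPowerComul lam) (dividedPowerLift lam lam)
    (dividedPower_algHom_ext (by
      have h : ∀ u v w : ShPlus k k lam, (Algebra.TensorProduct.assoc k k k _ _ _).toAlgHom
          ((u ⊗ₜ[k] v) ⊗ₜ[k] w) = u ⊗ₜ (v ⊗ₜ w) := fun _ _ _ => rfl
      simp only [AlgHom.comp_apply, dividedPowerComul_onePow_one, map_add, map_sub, map_smul,
        map_one, Algebra.TensorProduct.map_tmul, AlgHom.id_apply, TensorProduct.add_tmul,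
        TensorProduct.sub_tmul, TensorProduct.tmul_add, TensorProduct.tmul_sub,
        TensorProduct.tmul_smul, ← TensorProduct.smul_tmul', Algebra.TensorProduct.one_def,
        h]
      abel))
    (dividedPower_algHom_ext (by
      have h : lam ⊗ₜ[k] (1 : ShPlus k k lam) = lam • 1 := by
        rw [Algebra.TensorProduct.one_def, TensorProduct.smul_tmul', smul_eq_mul, mul_one]
      simp [dividedPowerComul_onePow_one, dividedPowerLift_onePow_one, h]))
    (dividedPower_algHom_ext (by
      have h : (1 : ShPlus k k lam) ⊗ₜ[k] lam = lam • 1 := by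
        rw [Algebra.TensorProduct.one_def, ← TensorProduct.tmul_smul, smul_eq_mul, mul_one]
      simp [dividedPowerComul_onePow_one, dividedPowerLift_onePow_one, h]))

/-- The divided power Hopf algebra as a Mathlib Hopf algebra. -/
abbrev dividedPowerHopfAlgebra (lam : k) : HopfAlgebra k (ShPlus k k lam) :=
  letI := dividedPowerBialgebra lam
  have hΔ : Bialgebra.comulAlgHom k (ShPlus k k lam) = dividedPowerComul lam := rfl
  have hε : Bialgebra.counitAlgHom k (ShPlus k k lam) = dividedPowerLift lam lam := rfl
  -- The antipode negates the primitive `u₁ - λ`, so it sends `u₁` to `2 λ - u₁`.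
  HopfAlgebra.ofAlgHom (dividedPowerLift lam ((2 * lam) • 1 - onePow lam 1))
    (dividedPower_algHom_ext (by
      rw [AlgHom.comp_apply, AlgHom.comp_apply, hΔ, hε, dividedPowerComul_onePow_one,
        dividedPowerLift_onePow_one, map_sub, map_add, map_smul, map_one]
      erw [Algebra.TensorProduct.lift_tmul, Algebra.TensorProduct.lift_tmul]
      rw [map_one, map_one, mul_one, one_mul, dividedPowerLift_onePow_one, AlgHom.id_apply,
        Algebra.ofId_apply, Algebra.algebraMap_eq_smul_one]
      module))
    (dividedPower_algHom_ext (by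
      rw [AlgHom.comp_apply, AlgHom.comp_apply, hΔ, hε, dividedPowerComul_onePow_one,
        dividedPowerLift_onePow_one, map_sub, map_add, map_smul, map_one]
      erw [Algebra.TensorProduct.lift_tmul, Algebra.TensorProduct.lift_tmul]
      rw [map_one, map_one, mul_one, one_mul, dividedPowerLift_onePow_one, AlgHom.id_apply,
        Algebra.ofId_apply, Algebra.algebraMap_eq_smul_one]
      module))

/-- The divided power Hopf algebra. -/
def dividedPower (lam : k) : HopfStructure k (ShPlus k k lam) :=
  letI := dividedPowerHopfAlgebra lam
  HopfStructure.ofHopfAlgebra k (ShPlus k k lam)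

theorem dividedPower_comul (u : ShPlus k k lam) :
    (dividedPower lam).comul u = dividedPowerComul lam u := rfl

theorem dividedPower_counit (u : ShPlus k k lam) :
    (dividedPower lam).counit u = dividedPowerLift lam lam u := rfl

theorem isDividedPower_dividedPower : IsDividedPower (dividedPower lam) lam (onePow lam) where
  comul_apply n := by
    rw [dividedPower_comul, dividedPowerComul, dividedPowerLift_onePow, ← onePowComul_eq,
      onePowComul]
    refine Finset.sum_congr rfl fun j _ => ?_
    rw [onePowConv, Finset.smul_sum, Finset.Nat.sum_antidiagonal_eq_sum_range_succ_mk]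
  counit_zero := map_one (dividedPowerLift lam lam)
  counit_one := dividedPowerLift_onePow_one lam
  counit_add_two n := by
    -- From index `2` on, the product contains the factor `λ - λ`.
    have h : ∀ n, dividedPowerSeq lam lam (n + 2) = 0 := by
      intro n
      induction n with
      | zero => simp [dividedPowerSeq]
      | succ n ih => rw [dividedPowerSeq, ih, mul_zero, smul_zero]
    rw [dividedPower_counit, dividedPowerLift_onePow, h]

theorem IsDividedPower.transport {R A B : Type*} [CommRing R] [Ring A] [Algebra R A] [Ring B]
    [Algebra R B] {H : HopfStructure R A} {lam : R} {u : ℕ → A} (h : IsDividedPower H lam u)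
    (e : A ≃ₐ[R] B) : IsDividedPower (H.transport e) lam (fun n => e (u n)) where
  comul_apply n := by
    refine ((H.isHopfHom_transport e).map_comul (u n)).trans ?_
    rw [h.comul_apply]
    simp
  counit_zero := ((H.isHopfHom_transport e).map_counit (u 0)).trans h.counit_zero
  counit_one := ((H.isHopfHom_transport e).map_counit (u 1)).trans h.counit_one
  counit_add_two n := ((H.isHopfHom_transport e).map_counit (u (n + 2))).trans (h.counit_add_two n)

end Field

/-! ### Independence of the two factors -/

namespace ShPlus

variable {R A B : Type*} [CommRing R] [NonUnitalCommRing A] [Module R A] [IsScalarTower R A A]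
  [SMulCommClass R A A] {lam : R}

section NonUnital

variable [NonUnitalCommRing B] [Module R B] [IsScalarTower R B B] [SMulCommClass R B B]

theorem map_cons (f : A →ₙₐ[R] B) (a : A) (u : ShPlus R A lam) :
    map f (cons a u) = cons (f a) (map f u) := by
  simp [map, cons]

/-- Applying a linear retraction to each letter gives a left inverse; injectivity concerns the
modules only, so `p` need not be multiplicative. -/
theorem map_injective {f : A →ₙₐ[R] B} (p : B →ₗ[R] A) (hp : ∀ a, p (f a) = a) :
    Function.Injective (map f : ShPlus R A lam → ShPlus R B lam) := by
  have h : wordRec 1 0 (consₗ ∘ₗ p) ∘ₗ (map f).toLinearMap =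
      (LinearMap.id : ShPlus R A lam →ₗ[R] ShPlus R A lam) := by
    refine hom_ext ?_ fun a u hu => ?_
    · simp [wordRec_one]
    · simp only [LinearMap.comp_apply, AlgHom.toLinearMap_apply, LinearMap.id_apply] at hu ⊢
      rw [map_cons, wordRec_cons, hu, LinearMap.comp_apply, hp]
      simp [consₗ_apply]
  exact Function.LeftInverse.injective (g := wordRec 1 0 (consₗ ∘ₗ p))
    fun u => LinearMap.congr_fun h u

end NonUnital

variable [CommRing B] [Algebra R B]

/-- The linear map `b ⊗ u ↦ φ b • u` removing the first letter. -/
def uncons (φ : B →ₗ[R] R) : Module.End R (ShPlus R B lam) :=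
  wordRec 0 (φ.smulRight LinearMap.id) 0

theorem uncons_cons (φ : B →ₗ[R] R) (b : B) (u : ShPlus R B lam) :
    uncons φ (cons b u) = φ b • u := by
  simp [uncons, wordRec_cons]

variable {f : A →ₙₐ[R] B} {φ : B →ₗ[R] R}

theorem uncons_map (hf : ∀ a, φ (f a) = 0) (u : ShPlus R A lam) : uncons φ (map f u) = 0 := by
  induction u using induction with
  | one => rw [map_one, uncons, wordRec_one]
  | cons a u _ => rw [map_cons, uncons_cons, hf, zero_smul]
  | add u v hu hv => rw [map_add, map_add, hu, hv, add_zero]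
  | smul r u hu => rw [map_smul, map_smul, hu, smul_zero]

/-- For a nonempty word with first letter `f a`, the three terms of the shuffle recursion start with
`1`, `f a` and `1 * f a`. Only the first survives `φ`, and its tail is the product with the leading
`1` removed. -/
theorem uncons_cons_one_mul_map (hf : ∀ a, φ (f a) = 0) (h₁ : φ 1 = 1) (v : ShPlus R B lam)
    (u : ShPlus R A lam) : uncons φ (cons 1 v * map f u) = v * map f u := by
  induction u using induction with
  | one => rw [map_one, mul_one, mul_one, uncons_cons, h₁, one_smul]
  | cons a u _ =>
    rw [map_cons, cons_mul_cons, map_add, map_add, map_smul, uncons_cons, uncons_cons, uncons_cons,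
      one_mul, hf, h₁, one_smul, zero_smul, zero_smul, smul_zero, add_zero, add_zero]
  | add u u' hu hu' => simp only [map_add, mul_add, hu, hu']
  | smul r u hu => simp only [map_smul, mul_smul_comm, hu]

theorem eq_zero_of_sum_word_mul_map_eq_zero (hf : ∀ a, φ (f a) = 0) (h₁ : φ 1 = 1)
    (hinj : Function.Injective (map f : ShPlus R A lam → ShPlus R B lam)) {N : ℕ}
    {z : ℕ → ShPlus R A lam}
    (hz : ∑ n ∈ Finset.range N, word (List.replicate n 1) * map f (z n) = 0) :
    ∀ n < N, z n = 0 := by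
  induction N generalizing z with
  | zero => intro n hn; omega
  | succ N ih =>
    -- The term `n = 0` has no leading `1` and is killed by `uncons φ`; the rest becomes a relation
    -- of length `N`. Once its coefficients vanish, the term `n = 0` is zero too.
    rw [Finset.sum_range_succ'] at hz
    simp only [List.replicate_succ, word_cons, List.replicate_zero, word_nil, one_mul] at hz
    have h := congrArg (uncons φ) hz
    rw [map_add, map_sum, uncons_map hf, add_zero, map_zero] at h
    simp only [uncons_cons_one_mul_map hf h₁] at h
    have h' := ih h
    rw [Finset.sum_eq_zero fun n hn => by rw [h' n (Finset.mem_range.1 hn), map_zero, mul_zero],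
      zero_add] at hz
    intro n hn
    cases n with
    | zero => exact hinj (hz.trans (map_zero _).symm)
    | succ n => exact h' n (by omega)

end ShPlus

theorem exists_sum_onePow_tmul {R M : Type*} [CommRing R] [AddCommGroup M] [Module R M] {lam : R}
    (t : ShPlus R R lam ⊗[R] M) :
    ∃ z : ℕ →₀ M, (z.sum fun n x => onePow lam n ⊗ₜ[R] x) = t := by
  suffices h : LinearMap.range (Finsupp.lsum R fun n => TensorProduct.mk R (ShPlus R R lam) M
      (onePow lam n)) = ⊤ from LinearMap.range_eq_top.1 h t
  rw [eq_top_iff, ← TensorProduct.span_tmul_eq_top, Submodule.span_le]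
  rintro _ ⟨u, x, rfl⟩
  rw [SetLike.mem_coe]
  induction u using onePow_induction with
  | onePow n => exact ⟨Finsupp.single n x, by simp⟩
  | add u v hu hv => rw [TensorProduct.add_tmul]; exact add_mem hu hv
  | smul r u hu => rw [← TensorProduct.smul_tmul']; exact Submodule.smul_mem _ r hu

/-! ### Injectivity for the algebras of a Hoffman set -/

section Embeddings

variable (k X : Type*) [Field k] [HoffmanSet X] (lam : k)

theorem gammaPlus_injective : Function.Injective (gammaPlus k (UnitalHoffmanAlgebra k X) lam) :=
  ShPlus.map_injective (Unitization.fstHom k (HoffmanAlgebra k X)).toLinearMap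
    fun r => (Unitization.fstHom k (HoffmanAlgebra k X)).commutes r

theorem inclPlus_injective : Function.Injective (inclPlus k X lam) :=
  ShPlus.map_injective (Unitization.sndHom k k (HoffmanAlgebra k X)) fun a => Unitization.snd_inr k a

/-- Every tensor is a finite sum of `uₙ ⊗ zₙ`, so the claim is the independence of the powers `1^{⊗
n}` over `Ш⁺(A)`, with `φ` the scalar part on `Ã`. -/
theorem productMap_gammaPlus_inclPlus_injective : Function.Injective
    (Algebra.TensorProduct.productMap (gammaPlus k (UnitalHoffmanAlgebra k X) lam)
      (inclPlus k X lam)) := by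
  rw [injective_iff_map_eq_zero]
  intro t ht
  obtain ⟨z, rfl⟩ := exists_sum_onePow_tmul t
  obtain ⟨N, hN⟩ := z.support.exists_nat_subset_range
  rw [Finsupp.sum_of_support_subset z hN _ (by simp)] at ht ⊢
  rw [map_sum] at ht
  simp only [Algebra.TensorProduct.productMap_apply_tmul, gammaPlus_onePow] at ht
  have h := ShPlus.eq_zero_of_sum_word_mul_map_eq_zero
    (f := Unitization.inrNonUnitalAlgHom k (HoffmanAlgebra k X))
    (φ := (Unitization.fstHom k (HoffmanAlgebra k X)).toLinearMap)
    (fun a => Unitization.fst_inr k a) (map_one (Unitization.fstHom k (HoffmanAlgebra k X)))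
    (inclPlus_injective k X lam) ht
  exact Finset.sum_eq_zero fun n hn => by rw [h n (Finset.mem_range.1 hn), TensorProduct.tmul_zero]

theorem includeRight_sh_injective : Function.Injective (Algebra.TensorProduct.includeRight :
    ShPlus k (UnitalHoffmanAlgebra k X) lam →ₐ[k] Sh k (UnitalHoffmanAlgebra k X) lam) :=
  Algebra.TensorProduct.includeRight_injective (FaithfulSMul.algebraMap_injective k _)

/-- The front factor of `Ш(k)` is a scalar and can be moved across the tensor sign, so the image of
`γ` lies in `1 ⊗ Ш⁺(Ã)`. -/
theorem gamma_eq : gamma k (UnitalHoffmanAlgebra k X) lam =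
    Algebra.TensorProduct.includeRight.comp ((gammaPlus k (UnitalHoffmanAlgebra k X) lam).comp
      (Algebra.TensorProduct.lid k (ShPlus k k lam) : Sh k k lam →ₐ[k] ShPlus k k lam)) := by
  refine Algebra.TensorProduct.ext' fun r u => ?_
  change algebraMap k (UnitalHoffmanAlgebra k X) r ⊗ₜ gammaPlus k _ lam u =
    1 ⊗ₜ gammaPlus k _ lam (r • u)
  rw [map_smul, Algebra.algebraMap_eq_smul_one, TensorProduct.smul_tmul]

theorem gamma_injective : Function.Injective (gamma k (UnitalHoffmanAlgebra k X) lam) := by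
  rw [gamma_eq]
  exact (includeRight_sh_injective k X lam).comp ((gammaPlus_injective k X lam).comp
    (Algebra.TensorProduct.lid k (ShPlus k k lam)).injective)

theorem incl_injective : Function.Injective (incl k X lam) :=
  (includeRight_sh_injective k X lam).comp (inclPlus_injective k X lam)

/-- Both factors lie in `1 ⊗ Ш⁺(Ã)`, where multiplication is that of `Ш⁺(Ã)`; this reduces the claim
to the one for `γ⁺`. -/
theorem productMap_gamma_incl_injective : Function.Injective
    (Algebra.TensorProduct.productMap (gamma k (UnitalHoffmanAlgebra k X) lam)
      (incl k X lam)) := by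
  have h : Algebra.TensorProduct.productMap (gamma k (UnitalHoffmanAlgebra k X) lam)
      (incl k X lam) = (Algebra.TensorProduct.includeRight.comp
        (Algebra.TensorProduct.productMap (gammaPlus k (UnitalHoffmanAlgebra k X) lam)
          (inclPlus k X lam))).comp
        (Algebra.TensorProduct.congr (Algebra.TensorProduct.lid k (ShPlus k k lam))
          (AlgEquiv.refl : ShPlus k (HoffmanAlgebra k X) lam ≃ₐ[k] _)).toAlgHom := by
    rw [gamma_eq]
    refine Algebra.TensorProduct.ext' fun u v => ?_
    rw [Algebra.TensorProduct.productMap_apply_tmul]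
    exact (map_mul Algebra.TensorProduct.includeRight _ _).symm
  rw [h]
  exact ((includeRight_sh_injective k X lam).comp
    (productMap_gammaPlus_inclPlus_injective k X lam)).comp (AlgEquiv.injective _)

end Embeddings

end MixableShuffle

end

open MixableShuffle in
theorem theorem3p3 (k : Subfield ℂ) (X : Type*) [HoffmanSet X] (lam : k) :
    ∃ (H₁ : HopfStructure k (ShPlus k k lam)) (H₁' : HopfStructure k (Sh k k lam))
      (H₂ : HopfStructure k (ShPlus k (HoffmanAlgebra k X) lam)),
      IsDividedPower H₁ lam (onePow lam) ∧
      IsDividedPower H₁' lam (fun n => 1 ⊗ₜ onePow lam n) ∧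
      IsDeconcatenation H₂ ∧
      (Function.Injective (gammaPlus k (UnitalHoffmanAlgebra k X) lam) ∧
        Function.Injective (inclPlus k X lam) ∧
        ∃ H : HopfStructure k (algProd (gammaPlus k (UnitalHoffmanAlgebra k X) lam).range
            (inclPlus k X lam).range),
          Expands (gammaPlus k (UnitalHoffmanAlgebra k X) lam) (inclPlus k X lam) H₁ H₂ H) ∧
      (Function.Injective (gamma k (UnitalHoffmanAlgebra k X) lam) ∧
        Function.Injective (incl k X lam) ∧
        ∃ H : HopfStructure k (algProd (gamma k (UnitalHoffmanAlgebra k X) lam).range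
            (incl k X lam).range),
          Expands (gamma k (UnitalHoffmanAlgebra k X) lam) (incl k X lam) H₁' H₂ H) := by
  refine ⟨dividedPower lam,
    -- The isomorphism `Ш⁺(k) ≃ k ⊗ Ш⁺(k)` sends `uₙ` to `1 ⊗ uₙ`, so the divided power formulas
    -- carry over.
    (dividedPower lam).transport (Algebra.TensorProduct.lid k (ShPlus k k lam)).symm,
    ShPlus.quasiShuffle k (HoffmanAlgebra k X) lam, isDividedPower_dividedPower,
    isDividedPower_dividedPower.transport _, ShPlus.isDeconcatenation_quasiShuffle,
    ⟨gammaPlus_injective k X lam, inclPlus_injective k X lam,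
      exists_expands _ _ _ _ (productMap_gammaPlus_inclPlus_injective k X lam)⟩,
    gamma_injective k X lam, incl_injective k X lam,
    exists_expands _ _ _ _ (productMap_gamma_incl_injective k X lam)⟩
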